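/- Definitions. For a set $\mathcal P$ of subgroups of a group $G$ and a subset $X\subseteq G$, write $\mathcal P\hookrightarrow_h(G,X)$ ($\mathcal P$ is hyperbolically embedded in $G$ with respect to $X$) if (a) $G$ is generated by $X\cup\bigcup_{P\in\mathcal P}P$ and the Cayley graph of $G$ with respect to the disjoint union $X\sqcup\bigsqcup_{P\in\mathcal P}P$ is hyperbolic, and (b) for each $P\in\mathcal P$, every ball of finite radius in $P$ is finite for the relative metric $\hat d_P$, where $\hat d_P(p,h)$ is the length of a shortest path from $p$ to $h$ in this Cayley graph that contains no edge labelled by $P$ between two vertices of $P$ ($\hat d_P(p,h)=\infty$ if there is none). A refinement of $\mathcal P$ in $G$ is a set of representatives of the $G$-conjugacy classes of the collection $\{\mathrm{Comm}_G(gPg^{-1}) : P\in\mathcal P,\ g\in G\}$, where $\mathrm{Comm}_G(P)=\{g\in G : P\cap gPg^{-1}\text{ has finite index in } P \text{ and in } gPg^{-1}\}$. For a subset $T$ of a group $H$, $\Gamma(H,T)$ is the Cayley graph with its path metric (with value $\infty$ between different components if $T$ does not generate $H$). Theorem. Let $H$ be a finite-index normal subgroup of a finitely generated group $G$, let $T\subseteq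 H$, and let $\mathcal Q$ be a finite collection of infinite subgroups of $H$ such that $\mathcal Q\hookrightarrow_h(H,T)$. Let $R$ be a transversal of $H$ in $G$. Suppose: 1. There are constants $L\ge 1$ and $C\ge 0$ such that for every $g\in R$ the conjugation $h\mapsto ghg^{-1}$ is an $(L,C)$-quasi-isometry of $\Gamma(H,T)$. (This holds in particular if the conjugation action of $G$ on $H$ is a uniform quasi-action on $\Gamma(H,T)$, that is, if this is so for all $g\in G$ with common constants; for example, if $T$ is invariant under conjugation by $G$.) 2. The collection $\{hQh^{-1} : h\in H,\ Q\in\mathcal Q\}$ is invariant under conjugation by $G$. Let $\mathcal Q^*$ be a refinement of $\mathcal Q$ in $G$. If $G$ is generated by $T\cup R\cup\bigcup_{P\in\mathcal Q^*}P$ (for example, if $T$ generates $H$), then $\mathcal Q^*\hookrightarrow_h(G,T\cup R)$. In every case there is a finite set $F\subseteq H$ such that $\mathcal Q^*\hookrightarrow_h(G,T\cup F\cup R)$. -/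

import Mathlib

open scoped NNReal ENNReal Pointwise

/-- A graph with its path metric is (Rips) hyperbolic: there is a constant `δ` such that every
geodesic triangle is `δ`-slim. A geodesic is a walk whose length is the distance of its
endpoints. -/
def GraphHyperbolic {V : Type*} (Γ : SimpleGraph V) : Prop :=
  ∃ δ : ℕ, ∀ (x y z : V) (p : Γ.Walk x y) (q : Γ.Walk y z) (r : Γ.Walk x z),
    p.length = Γ.dist x y → q.length = Γ.dist y z → r.length = Γ.dist x z →
      ∀ v ∈ p.support, ∃ w, (w ∈ q.support ∨ w ∈ r.support) ∧ Γ.edist v w ≤ δ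

/-- `f` is an `(L, C)`-quasi-isometry from the vertices of `Γ` to the vertices of `Γ'`, for the
path metrics (the distance of vertices in different components is infinite). -/
def IsGraphQuasiIsometry {V W : Type*} (Γ : SimpleGraph V) (Γ' : SimpleGraph W)
    (L C : ℝ≥0) (f : V → W) : Prop :=
  (∀ x y, (Γ'.edist (f x) (f y) : ℝ≥0∞) ≤ L * (Γ.edist x y : ℝ≥0∞) + C) ∧
  (∀ x y, (Γ.edist x y : ℝ≥0∞) / L ≤ (Γ'.edist (f x) (f y) : ℝ≥0∞) + C) ∧
  (∀ w, ∃ x, (Γ'.edist w (f x) : ℝ≥0∞) ≤ C)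

section

variable {G : Type*} [Group G]

/-- The Cayley graph of `G` with respect to the disjoint union of `X` and the members of `𝒜`, from
which the edges labelled by the member `P` and joining two vertices of `P` have been removed.
Edges between vertices of `P` with a label in `X` or in another member of `𝒜` are kept. -/
def relCayleyMinus (𝒜 : Set (Subgroup G)) (X : Set G) (P : Subgroup G) : SimpleGraph G where
  Adj u v := u ≠ v ∧
    ((∃ x ∈ X, u * x = v ∨ u = v * x) ∨ ∃ K ∈ 𝒜, u⁻¹ * v ∈ K ∧ ¬ (K = P ∧ u ∈ P))
  symm := ⟨by
    rintro u v ⟨hne, h | ⟨K, hK, hm, hn⟩⟩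
    · obtain ⟨x, hx, h | h⟩ := h
      · exact ⟨hne.symm, Or.inl ⟨x, hx, Or.inr h.symm⟩⟩
      · exact ⟨hne.symm, Or.inl ⟨x, hx, Or.inl h.symm⟩⟩
    · refine ⟨hne.symm, Or.inr ⟨K, hK, ?_, ?_⟩⟩
      · simpa using K.inv_mem hm
      · rintro ⟨rfl, hv⟩
        exact hn ⟨rfl, by simpa using K.mul_mem hv (K.inv_mem hm)⟩⟩
  loopless := ⟨fun _ h => h.1 rfl⟩

/-- `𝒜 ↪_h (G, X)`: the collection `𝒜` of subgroups is hyperbolically embedded in `G` with respect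
to the subset `X`. That is, `X` and the members of `𝒜` generate `G`, the Cayley graph
`Γ(G, X ⊔ ⨆ 𝒜)` is hyperbolic, and for each `P ∈ 𝒜` the balls of finite radius in `P` are finite
for the relative metric: the length of a shortest path in that Cayley graph without edges
of the complete graph on `P` labelled by `P`. -/
def HypEmbedded (𝒜 : Set (Subgroup G)) (X : Set G) : Prop :=
  Subgroup.closure (X ∪ ⋃ P ∈ 𝒜, (P : Set G)) = ⊤ ∧
  GraphHyperbolic (SimpleGraph.mulCayley (X ∪ ⋃ P ∈ 𝒜, (P : Set G))) ∧
  ∀ P ∈ 𝒜, ∀ p ∈ P, ∀ n : ℕ, {h ∈ (P : Set G) | (relCayleyMinus 𝒜 X P).edist p h ≤ n}.Finite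

/-- The subgroups `Comm_G(g P g⁻¹)` with `P ∈ 𝒜` and `g ∈ G`. -/
def commensuratorConjugates (𝒜 : Set (Subgroup G)) : Set (Subgroup G) :=
  {K | ∃ P ∈ 𝒜, ∃ g : G, K = Subgroup.Commensurable.commensurator (MulAut.conj g • P)}

/-- `𝒜'` is a refinement of `𝒜` in `G`: a set of representatives of the conjugacy classes of the
collection of all `Comm_G(g P g⁻¹)`. -/
def IsRefinement (𝒜 𝒜' : Set (Subgroup G)) : Prop :=
  𝒜' ⊆ commensuratorConjugates 𝒜 ∧
  ∀ K ∈ commensuratorConjugates 𝒜, ∃! P, P ∈ 𝒜' ∧ ∃ g : G, P = MulAut.conj g • K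

/-- The conjugates `h Q h⁻¹` with `Q ∈ 𝒬` and `h` in the ambient group. -/
def conjugateSubgroups (𝒬 : Set (Subgroup G)) : Set (Subgroup G) :=
  {K | ∃ Q ∈ 𝒬, ∃ h : G, K = MulAut.conj h • Q}

/-- Conjugation by the elements of `A ⊆ G` on the normal subgroup `H` is by quasi-isometries of the
Cayley graph `Γ(H, T)` with uniform constants. For `A = G` this says that the conjugation action
of `G` on `H` is a uniform quasi-action on `Γ(H, T)`. -/
def ConjUniformOn (H : Subgroup G) [H.Normal] (T : Set H) (A : Set G) : Prop :=
  ∃ L C : ℝ≥0, 1 ≤ L ∧ ∀ g ∈ A,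
    IsGraphQuasiIsometry (SimpleGraph.mulCayley T) (SimpleGraph.mulCayley T) L C
      (fun h : H => MulAut.conjNormal g h)

end

/-! Write G = HR and let ρ : G → H take the H-component, so that ρ(hx) = hρ(x) and ρ(x)⁻¹x ∈ R. The
inclusion of H and the map ρ compare the relative Cayley graphs of H and G.

The algebra comes from almost malnormality: infinitely many x ∈ Q ∩ gQ'g⁻¹ would be joined to 1 by
paths of length 3 avoiding the edges of Q, after g and g⁻¹ are added to the generators
(`RelLocallyFinite.eq_and_mem_of_infinite`). By the invariance of the conjugates of members of 𝒬,
the commensurator in G of such a conjugate K is its normalizer, and it meets H in K. Hence the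
cosets of the members of the refinement match the H-conjugates of the members of 𝒬;
`IsPeripheralExtension` records this.

Each P in the refinement is finitely many cosets of P ∩ H, a conjugate of some Q. So ρ sends a
P-edge to a path k, q, f with q ∈ Q and k, f in a fixed finite set. Together with the bound on the
T-length of rtr⁻¹, this makes ρ Lipschitz; the inclusion is Lipschitz too, and ρ(x) is within 1 of
x. Hyperbolicity follows from `GraphHyperbolic.of_coarseRetract`, proved by guessing geodesics. For
the relative metrics, ρ must not send a kept edge onto a removed one, which is the matching of
cosets above; a ball in P is then controlled by a ball in Q.

Since H is finitely generated, a finite set F can be added to T so that T ∪ F generates H;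
`HypEmbedded.union_finite` shows that this is harmless. -/

namespace SimpleGraph

variable {V W : Type*} {Γ : SimpleGraph V} {Γ' : SimpleGraph W}

/-! ### Distances, Lipschitz maps and geodesics in graphs -/

lemma exists_walk_length_le_of_edist_le {n : ℕ} {x y : V} (h : Γ.edist x y ≤ n) :
    ∃ p : Γ.Walk x y, p.length ≤ n := by
  obtain ⟨p, hp⟩ := exists_walk_of_edist_ne_top (ne_top_of_le_ne_top (ENat.natCast_ne_top n) h)
  exact ⟨p, by rw [← hp] at h; exact_mod_cast h⟩

lemma edist_map_le {f : V → W} {m : ℕ} (hf : ∀ x y, Γ.Adj x y → Γ'.edist (f x) (f y) ≤ m)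
    {n : ℕ} {x y : V} (h : Γ.edist x y ≤ n) : Γ'.edist (f x) (f y) ≤ (m * n : ℕ) := by
  obtain ⟨p, hp⟩ := exists_walk_length_le_of_edist_le h
  have key : Γ'.edist (f x) (f y) ≤ (m * p.length : ℕ) := by
    clear hp h
    induction p with
    | nil => simp
    | @cons a b c hab q ih =>
      refine (SimpleGraph.edist_triangle (v := f b)).trans ?_
      refine (add_le_add (hf _ _ hab) ih).trans ?_
      rw [Walk.length_cons, mul_add, mul_one, add_comm]
      push_cast
      exact le_rfl
  exact key.trans (by exact_mod_cast Nat.mul_le_mul_left m hp)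

lemma edist_le_add {x y z : V} {m n : ℕ} (h : Γ.edist x y ≤ m) (h' : Γ.edist y z ≤ n) :
    Γ.edist x z ≤ (m + n : ℕ) := by
  push_cast
  exact SimpleGraph.edist_triangle.trans (add_le_add h h')

lemma Connected.edist_le_iff (hΓ : Γ.Connected) {x y : V} {n : ℕ} :
    Γ.edist x y ≤ n ↔ Γ.dist x y ≤ n := by
  rw [← (hΓ.preconnected x y).coe_dist_eq_edist]
  exact Nat.cast_le

lemma Connected.dist_map_le (hΓ : Γ.Connected) (hΓ' : Γ'.Connected) {f : V → W} {m : ℕ}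
    (hf : ∀ x y, Γ.Adj x y → Γ'.dist (f x) (f y) ≤ m) (x y : V) :
    Γ'.dist (f x) (f y) ≤ m * Γ.dist x y := by
  rw [← hΓ'.edist_le_iff]
  exact edist_map_le (fun x y h => hΓ'.edist_le_iff.2 (hf x y h)) (hΓ.edist_le_iff.2 le_rfl)

lemma Walk.dist_getVert_le {x y : V} (p : Γ.Walk x y) {i j : ℕ} (hij : i ≤ j) :
    Γ.dist (p.getVert i) (p.getVert j) ≤ j - i := by
  have h := dist_le ((p.drop i).take (j - i))
  rw [Walk.take_length] at h
  simp only [Walk.drop_getVert, Nat.add_sub_cancel' hij] at h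
  omega

lemma Connected.sub_le_dist_getVert (hΓ : Γ.Connected) {x y : V} {p : Γ.Walk x y}
    (hp : p.length = Γ.dist x y) {i j : ℕ} (hij : i ≤ j) (hj : j ≤ p.length) :
    j - i ≤ Γ.dist (p.getVert i) (p.getVert j) := by
  have h1 := p.dist_getVert_le (Nat.zero_le i)
  have h2 := p.dist_getVert_le hj
  rw [Walk.getVert_zero] at h1
  rw [Walk.getVert_length] at h2
  have h3 := hΓ.dist_triangle (u := x) (v := p.getVert i) (w := y)
  have h4 := hΓ.dist_triangle (u := p.getVert i) (v := p.getVert j) (w := y)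
  omega

/-! ### The guessing geodesics criterion -/

/-- A family of coarse paths `η x y` joining the pairs of vertices of a graph, with thin
triangles. -/
structure IsCoarsePathFamily (Γ : SimpleGraph V) (D : ℕ) (η : V → V → Set V) : Prop where
  coarse_path : ∀ x y, ∃ (m : ℕ) (w : ℕ → V), (∀ j ≤ m, w j ∈ η x y) ∧ Γ.dist (w 0) x ≤ D ∧
    Γ.dist (w m) y ≤ D ∧ ∀ j < m, Γ.dist (w j) (w (j + 1)) ≤ D
  dist_le_of_dist_le_one : ∀ x y, Γ.dist x y ≤ 1 → ∀ w ∈ η x y, Γ.dist w x ≤ D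
  thin : ∀ x y z, ∀ w ∈ η x y, ∃ w', (w' ∈ η x z ∨ w' ∈ η z y) ∧ Γ.dist w w' ≤ D

namespace IsCoarsePathFamily

variable {D : ℕ} {η : V → V → Set V}

/-- Dyadic subdivision: each of the n halvings costs one thin triangle, hence D. The bound is
logarithmic in the length of the path β. -/
lemma near_path (hη : IsCoarsePathFamily Γ D η) (hΓ : Γ.Connected) {β : ℕ → V}
    (hβ : ∀ k, Γ.dist (β k) (β (k + 1)) ≤ 1) (n : ℕ) :
    ∀ i j, i ≤ j → j ≤ i + 2 ^ n → ∀ w ∈ η (β i) (β j),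
      ∃ k, i ≤ k ∧ k ≤ j ∧ Γ.dist w (β k) ≤ D * (n + 1) := by
  induction n with
  | zero =>
    intro i j hij hj w hw
    refine ⟨i, le_rfl, hij, ?_⟩
    have : Γ.dist (β i) (β j) ≤ 1 := by
      obtain rfl | rfl : j = i ∨ j = i + 1 := by simp at hj; omega
      · simp
      · exact hβ i
    simpa using hη.dist_le_of_dist_le_one _ _ this w hw
  | succ n ih =>
    intro i j hij hj w hw
    rw [pow_succ] at hj
    obtain ⟨w', hw', hd⟩ := hη.thin _ _ (β (min j (i + 2 ^ n))) w hw
    have key : ∃ k, i ≤ k ∧ k ≤ j ∧ Γ.dist w' (β k) ≤ D * (n + 1) := by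
      rcases hw' with hw' | hw'
      · obtain ⟨k, h1, h2, h3⟩ := ih i _ (by omega) (by omega) w' hw'
        exact ⟨k, h1, by omega, h3⟩
      · obtain ⟨k, h1, h2, h3⟩ := ih _ j (by omega) (by omega) w' hw'
        exact ⟨k, by omega, h2, h3⟩
    obtain ⟨k, h1, h2, h3⟩ := key
    have := hΓ.dist_triangle (u := w) (v := w') (w := β k)
    exact ⟨k, h1, h2, by linarith⟩

/-- Bootstrapping a bound t. If w is t-close to β k, cut β at distance 2t + 2D + 1 on both sides of
k. Then w is 2D-close to one of the three pieces. An outer piece would give a shortcut of the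
geodesic, unless it is degenerate and lies near an endpoint. The middle piece has length at most 4t
+ 4D + 2, so the logarithmic bound D(n + 1) applies and 2D is added. -/
lemma near_geodesic_step (hη : IsCoarsePathFamily Γ D η) (hΓ : Γ.Connected) {β : ℕ → V}
    (hβ : ∀ k, Γ.dist (β k) (β (k + 1)) ≤ 1) {N : ℕ}
    (hgeo : ∀ i j, i ≤ j → j ≤ N → j - i ≤ Γ.dist (β i) (β j)) {t n : ℕ}
    (htn : 4 * t + 4 * D + 2 ≤ 2 ^ n)
    (ht : ∀ i j, i ≤ j → j ≤ N → ∀ w ∈ η (β i) (β j),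
      ∃ k, i ≤ k ∧ k ≤ j ∧ Γ.dist w (β k) ≤ t) :
    ∀ i j, i ≤ j → j ≤ N → ∀ w ∈ η (β i) (β j),
      ∃ k, i ≤ k ∧ k ≤ j ∧ Γ.dist w (β k) ≤ D * (n + 3) := by
  intro i j hij hj w hw
  obtain ⟨k, hik, hkj, hk⟩ := ht i j hij hj w hw
  obtain ⟨a, ha⟩ : ∃ a, a = max i (k - (2 * t + 2 * D + 1)) := ⟨_, rfl⟩
  obtain ⟨b, hb⟩ : ∃ b, b = min j (k + (2 * t + 2 * D + 1)) := ⟨_, rfl⟩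
  have hD : D * 3 ≤ D * (n + 3) := Nat.mul_le_mul_left D (by omega)
  have tri := fun u v z => hΓ.dist_triangle (u := u) (v := v) (w := z)
  obtain ⟨w₁, hw₁ | hw₁, hd₁⟩ := hη.thin _ _ (β a) w hw
  · obtain ⟨l, hil, hla, hl⟩ := ht i a (by omega) (by omega) w₁ hw₁
    rcases (show a = i ∨ k - l ≥ 2 * t + 2 * D + 1 by omega) with h | h
    · rw [h] at hw₁
      have h1 := hη.dist_le_of_dist_le_one _ _ (by simp) w₁ hw₁
      have := tri w w₁ (β i)
      exact ⟨i, le_rfl, hij, by omega⟩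
    · have h1 := hgeo l k (by omega) (by omega)
      have h2 := tri (β l) w₁ (β k)
      have h3 := tri w₁ w (β k)
      rw [dist_comm (u := β l) (v := w₁)] at h2
      rw [dist_comm (u := w₁) (v := w)] at h3
      omega
  · obtain ⟨w₂, hw₂ | hw₂, hd₂⟩ := hη.thin _ _ (β b) w₁ hw₁
    · obtain ⟨l, h1, h2, h3⟩ := hη.near_path hΓ hβ n a b (by omega) (by omega) w₂ hw₂
      refine ⟨l, by omega, by omega, ?_⟩
      have h4 := tri w w₁ (β l)
      have h5 := tri w₁ w₂ (β l)
      linarith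
    · obtain ⟨l, hil, hla, hl⟩ := ht b j (by omega) (by omega) w₂ hw₂
      have h0 := tri w w₁ w₂
      rcases (show b = j ∨ l - k ≥ 2 * t + 2 * D + 1 by omega) with h | h
      · rw [h] at hw₂
        have h1 := hη.dist_le_of_dist_le_one _ _ (by simp) w₂ hw₂
        have := tri w w₂ (β j)
        exact ⟨j, hij, le_rfl, by omega⟩
      · have h1 := hgeo k l (by omega) (by omega)
        have h2 := tri (β k) w (β l)
        have h3 := tri w w₂ (β l)
        rw [dist_comm (u := β k) (v := w)] at h2
        omega

/-- With t = D(n + 4) this is the hypothesis of `near_geodesic_step`, which then improves the bound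
to D(n + 3). -/
lemma exists_linear_le_two_pow (D : ℕ) :
    ∃ n₀, ∀ n, n₀ ≤ n → 4 * (D * (n + 4)) + 4 * D + 2 ≤ 2 ^ n := by
  refine ⟨2 * (8 * D + 20), fun n hn => ?_⟩
  induction n, hn using Nat.le_induction with
  | base =>
    have h : 8 * D + 20 < 2 ^ (8 * D + 20) := Nat.lt_two_pow_self
    rw [mul_comm 2, pow_mul]
    nlinarith
  | succ n hn ih =>
    rw [pow_succ]
    nlinarith

/-- Coarse path families stay uniformly close to geodesics. -/
lemma exists_near_geodesic (hη : IsCoarsePathFamily Γ D η) (hΓ : Γ.Connected) :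
    ∃ K, ∀ (N : ℕ) (β : ℕ → V), (∀ k, Γ.dist (β k) (β (k + 1)) ≤ 1) →
      (∀ i j, i ≤ j → j ≤ N → j - i ≤ Γ.dist (β i) (β j)) →
      ∀ w ∈ η (β 0) (β N), ∃ k, k ≤ N ∧ Γ.dist w (β k) ≤ K := by
  obtain ⟨n₀, hn₀⟩ := exists_linear_le_two_pow D
  refine ⟨D * (n₀ + 3), fun N β hβ hgeo => ?_⟩
  -- The logarithmic bound gives a start that depends on N; each bootstrapping step lowers the
  -- coefficient of D by one, until N has disappeared.
  suffices H : ∀ m, ∀ i j, i ≤ j → j ≤ N → ∀ w ∈ η (β i) (β j),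
      ∃ k, i ≤ k ∧ k ≤ j ∧ Γ.dist w (β k) ≤ D * (n₀ + (N - m) + 3) by
    intro w hw
    obtain ⟨k, -, h2, h3⟩ := H N 0 N (Nat.zero_le _) le_rfl w hw
    exact ⟨k, h2, by simpa using h3⟩
  intro m
  induction m with
  | zero =>
    intro i j hij hj w hw
    have hN : N < 2 ^ N := Nat.lt_two_pow_self
    obtain ⟨k, h1, h2, h3⟩ := hη.near_path hΓ hβ N i j hij (by omega) w hw
    exact ⟨k, h1, h2, h3.trans (Nat.mul_le_mul_left D (by omega))⟩
  | succ m ih =>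
    rcases Nat.lt_or_ge m N with h | h
    · refine hη.near_geodesic_step hΓ hβ hgeo ?_ ih
      have e : n₀ + (N - m) + 3 = n₀ + (N - (m + 1)) + 4 := by omega
      rw [e]
      exact hn₀ _ (by omega)
    · rwa [show N - (m + 1) = N - m by omega]

end IsCoarsePathFamily

/-- A discrete intermediate value theorem: take the first j with k ≤ i j + c. -/
lemma exists_index_near {m N c : ℕ} {i : ℕ → ℕ} (h0 : i 0 ≤ c) (hm : N ≤ i m + c)
    (hs : ∀ j < m, i (j + 1) ≤ i j + c) {k : ℕ} (hk : k ≤ N) :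
    ∃ j ≤ m, i j ≤ k + c ∧ k ≤ i j + c := by
  have hex : ∃ j, j ≤ m ∧ k ≤ i j + c := ⟨m, le_rfl, by omega⟩
  classical
  obtain ⟨h1, h2⟩ := Nat.find_spec hex
  refine ⟨Nat.find hex, h1, ?_, h2⟩
  rcases Nat.eq_zero_or_pos (Nat.find hex) with h | h
  · rw [h]; omega
  · have h3 := Nat.find_min hex (m := Nat.find hex - 1) (by omega)
    have h4 := hs (Nat.find hex - 1) (by omega)
    rw [Nat.sub_add_cancel h] at h4
    have : ¬ (k ≤ i (Nat.find hex - 1) + c) := fun h' => h3 ⟨by omega, h'⟩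
    omega

/-- The guessing geodesics criterion for hyperbolicity. -/
theorem IsCoarsePathFamily.graphHyperbolic {D : ℕ} {η : V → V → Set V}
    (hη : IsCoarsePathFamily Γ D η) (hΓ : Γ.Connected) : GraphHyperbolic Γ := by
  obtain ⟨K, hK⟩ := hη.exists_near_geodesic hΓ
  have tri := fun u v z => hΓ.dist_triangle (u := u) (v := v) (w := z)
  have near : ∀ {x y : V} (p : Γ.Walk x y), p.length = Γ.dist x y → ∀ w ∈ η x y,
      ∃ k ≤ p.length, Γ.dist w (p.getVert k) ≤ K := fun {x y} p hp w hw =>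
    hK p.length p.getVert (fun k => by simpa using p.dist_getVert_le (Nat.le_succ k))
      (fun i j hij hj => hΓ.sub_le_dist_getVert hp hij hj) w (by simpa using hw)
  -- The projections to p of consecutive coarse path points differ by at most 2K + D, so one of them
  -- is that close to v. Then K leads to the coarse path, D across the thin triangle, and K to
  -- another side.
  refine ⟨(2 * K + D) + K + D + K, fun x y z p q r hp hq hr v hv => ?_⟩
  obtain ⟨k, rfl, hk⟩ := Walk.mem_support_iff_exists_getVert.1 hv
  obtain ⟨m, w, hwη, hw0, hwm, hws⟩ := hη.coarse_path x y
  have hex : ∀ j, ∃ i, j ≤ m → i ≤ p.length ∧ Γ.dist (w j) (p.getVert i) ≤ K := fun j => by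
    by_cases hj : j ≤ m
    · obtain ⟨i, hi⟩ := near p hp (w j) (hwη j hj)
      exact ⟨i, fun _ => hi⟩
    · exact ⟨0, fun h => absurd h hj⟩
  choose i hi using hex
  obtain ⟨j, hjm, hj1, hj2⟩ : ∃ j ≤ m, i j ≤ k + (2 * K + D) ∧ k ≤ i j + (2 * K + D) := by
    refine exists_index_near (N := p.length) ?_ ?_ ?_ hk
    · obtain ⟨h1, h2⟩ := hi 0 (Nat.zero_le m)
      have h3 := hΓ.sub_le_dist_getVert hp (Nat.zero_le (i 0)) h1
      rw [Walk.getVert_zero] at h3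
      have h4 := tri x (w 0) (p.getVert (i 0))
      rw [dist_comm (u := x) (v := w 0)] at h4
      omega
    · obtain ⟨h1, h2⟩ := hi m le_rfl
      have h3 := hΓ.sub_le_dist_getVert hp h1 le_rfl
      rw [Walk.getVert_length] at h3
      have h4 := tri (p.getVert (i m)) (w m) y
      rw [dist_comm (u := p.getVert (i m)) (v := w m)] at h4
      omega
    · intro j hj
      obtain ⟨h1, h2⟩ := hi j hj.le
      obtain ⟨h1', h2'⟩ := hi (j + 1) hj
      by_contra hlt
      have h3 := hΓ.sub_le_dist_getVert hp (i := i j) (j := i (j + 1)) (by omega) h1'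
      have h4 := tri (p.getVert (i j)) (w j) (p.getVert (i (j + 1)))
      have h5 := tri (w j) (w (j + 1)) (p.getVert (i (j + 1)))
      have h6 := hws j hj
      rw [dist_comm (u := p.getVert (i j)) (v := w j)] at h4
      omega
  have hd : Γ.dist (p.getVert k) (w j) ≤ 2 * K + D + K := by
    have h1 := tri (p.getVert k) (p.getVert (i j)) (w j)
    have h2 := (hi j hjm).2
    rw [dist_comm] at h2
    have h3 : Γ.dist (p.getVert k) (p.getVert (i j)) ≤ 2 * K + D := by
      rcases le_total k (i j) with h | h
      · have := p.dist_getVert_le h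
        omega
      · have := p.dist_getVert_le h
        rw [dist_comm] at this
        omega
    omega
  obtain ⟨w', hw', hww'⟩ := hη.thin x y z (w j) (hwη j hjm)
  simp only [hΓ.edist_le_iff]
  have h1 := tri (p.getVert k) (w j) w'
  rcases hw' with hw' | hw'
  · obtain ⟨l, -, hl⟩ := near r hr w' hw'
    refine ⟨r.getVert l, Or.inr (r.getVert_mem_support l), ?_⟩
    have h2 := tri (p.getVert k) w' (r.getVert l)
    omega
  · obtain ⟨l, -, hl⟩ := near q.reverse (by rw [Walk.length_reverse, hq, dist_comm]) w' hw'
    refine ⟨q.reverse.getVert l, Or.inl ?_, ?_⟩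
    · have := q.reverse.getVert_mem_support l
      simpa using this
    · have h2 := tri (p.getVert k) w' (q.reverse.getVert l)
      omega

end SimpleGraph

/-! ### Hyperbolicity of coarse retracts -/

open SimpleGraph

/-- Hyperbolicity passes to coarse Lipschitz retracts. -/
theorem GraphHyperbolic.of_coarseRetract {V W : Type*} {Γ : SimpleGraph V} {Γ' : SimpleGraph W}
    (h : GraphHyperbolic Γ) (hΓ : Γ.Connected) (hΓ' : Γ'.Connected) {f : V → W} {g : W → V}
    {A : ℕ} (hf : ∀ x y, Γ.Adj x y → Γ'.dist (f x) (f y) ≤ A)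
    (hg : ∀ x y, Γ'.Adj x y → Γ.dist (g x) (g y) ≤ A)
    (hfg : ∀ x, Γ'.dist (f (g x)) x ≤ A) : GraphHyperbolic Γ' := by
  obtain ⟨δ, hδ⟩ := h
  have hf' := hΓ.dist_map_le hΓ' hf
  have hg' := hΓ'.dist_map_le hΓ hg
  -- The guessed paths are the f-images of geodesics between g x and g y. In D, the term A * A + A
  -- bounds paths between neighbours and A * δ the images of thin triangles.
  refine IsCoarsePathFamily.graphHyperbolic (D := A * A + A + A * δ) (η := fun x y =>
    {w | ∃ p : Γ.Walk (g x) (g y), p.length = Γ.dist (g x) (g y) ∧ ∃ v ∈ p.support, f v = w})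
    ⟨fun x y => ?_, fun x y hxy w hw => ?_, fun x y z w hw => ?_⟩ hΓ'
  · obtain ⟨p, hp⟩ := hΓ.exists_walk_length_eq_dist (g x) (g y)
    refine ⟨p.length, fun j => f (p.getVert j), fun j _ => ⟨p, hp, _, p.getVert_mem_support j, rfl⟩,
      ?_, ?_, fun j _ => ?_⟩
    · simpa using (hfg x).trans (by omega)
    · simpa using (hfg y).trans (by omega)
    · refine (hf' _ _).trans ?_
      have h1 := p.dist_getVert_le (Nat.le_succ j)
      rw [Nat.succ_sub (le_refl j), Nat.sub_self] at h1
      have := Nat.mul_le_mul_left A h1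
      simp only [Nat.succ_eq_add_one] at this
      omega
  · obtain ⟨p, hp, v, hv, rfl⟩ := hw
    obtain ⟨k, rfl, hk⟩ := Walk.mem_support_iff_exists_getVert.1 hv
    have h1 := p.dist_getVert_le (Nat.zero_le k)
    rw [Walk.getVert_zero, dist_comm] at h1
    have h2 : Γ.dist (p.getVert k) (g x) ≤ A := by
      have h3 := hg' x y
      have h4 := Nat.mul_le_mul_left A hxy
      omega
    have h3 := hf' (p.getVert k) (g x)
    have h4 := Nat.mul_le_mul_left A h2
    have h5 := hΓ'.dist_triangle (u := f (p.getVert k)) (v := f (g x)) (w := x)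
    have h6 := hfg x
    omega
  · obtain ⟨p, hp, v, hv, rfl⟩ := hw
    obtain ⟨q, hq⟩ := hΓ.exists_walk_length_eq_dist (g y) (g z)
    obtain ⟨r, hr⟩ := hΓ.exists_walk_length_eq_dist (g x) (g z)
    obtain ⟨u, hu, hvu⟩ := hδ _ _ _ p q r hp hq hr v hv
    refine ⟨f u, ?_, ?_⟩
    · rcases hu with hu | hu
      · exact Or.inr ⟨q.reverse, by rw [Walk.length_reverse, hq, dist_comm], u, by simpa using hu, rfl⟩
      · exact Or.inl ⟨r, hr, u, hu, rfl⟩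
    · have h1 := hf' v u
      have h2 := Nat.mul_le_mul_left A (hΓ.edist_le_iff.1 hvu)
      omega

/-! ### Cayley graphs -/

section CayleyGraphs

variable {A : Type*} [Group A]

lemma mulCayley_edist_mul_le_one {S : Set A} {s : A} (hs : s ∈ S) (u : A) :
    (mulCayley S).edist u (u * s) ≤ 1 := by
  rw [edist_le_one_iff_adj_or_eq, or_iff_not_imp_right]
  exact fun h => (mulCayley_adj' S _ _).2 ⟨h, s, hs, Or.inl rfl⟩

lemma mulCayley_edist_mul_left (S : Set A) (g u v : A) :
    (mulCayley S).edist (g * u) (g * v) = (mulCayley S).edist u v := by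
  have key : ∀ (g u v : A), (mulCayley S).edist (g * u) (g * v) ≤ (mulCayley S).edist u v := by
    intro g u v
    by_cases h : (mulCayley S).edist u v = ⊤
    · rw [h]; exact le_top
    · obtain ⟨n, hn⟩ := ENat.ne_top_iff_exists.1 h
      have := edist_map_le (Γ := mulCayley S) (Γ' := mulCayley S) (f := (g * ·)) (m := 1)
        (fun x y hxy => le_of_eq (edist_eq_one_iff_adj.2 (mulCayley_adj_mul_iff_right.2 hxy)))
        (x := u) (y := v) (n := n) hn.ge
      rw [← hn]
      simpa using this
  refine le_antisymm (key g u v) ?_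
  simpa using key g⁻¹ (g * u) (g * v)

lemma mulCayley_dist_mul_left (S : Set A) (g u v : A) :
    (mulCayley S).dist (g * u) (g * v) = (mulCayley S).dist u v :=
  congrArg ENat.toNat (mulCayley_edist_mul_left S g u v)

lemma mulCayley_reachable_of_mem_closure {S : Set A} {x : A} (hx : x ∈ Subgroup.closure S) (u : A) :
    (mulCayley S).Reachable u (u * x) := by
  induction hx using Subgroup.closure_induction generalizing u with
  | mem x hx =>
    exact reachable_of_edist_ne_top
      (ne_top_of_le_ne_top ENat.one_ne_top (mulCayley_edist_mul_le_one hx u))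
  | one => simp
  | mul x y _ _ hx hy => rw [← mul_assoc]; exact (hx u).trans (hy _)
  | inv x _ hx => simpa using (hx (u * x⁻¹)).symm

lemma mulCayley_connected {S : Set A} (hS : Subgroup.closure S = ⊤) : (mulCayley S).Connected := by
  refine (connected_iff _).2 ⟨fun u v => ?_, ⟨1⟩⟩
  simpa using mulCayley_reachable_of_mem_closure (S := S) (x := u⁻¹ * v) (by simp [hS]) u

lemma dist_le_of_mulCayley_adj {S : Set A} {W : Type*} {Γ : SimpleGraph W} {f : A → W} {m : ℕ}
    (h : ∀ s ∈ S, ∀ u, Γ.dist (f u) (f (u * s)) ≤ m) (u v : A) (huv : (mulCayley S).Adj u v) :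
    Γ.dist (f u) (f v) ≤ m := by
  obtain ⟨-, s, hs, rfl | rfl⟩ := (mulCayley_adj' S u v).1 huv
  · exact h s hs u
  · rw [dist_comm]; exact h s hs v

end CayleyGraphs

/-! ### Relative metrics under enlargement of the generating set -/

section RelativeMetric

variable {A : Type*} [Group A] {𝒜 : Set (Subgroup A)} {X Y : Set A} {P : Subgroup A}

lemma relCayleyMinus_edist_mul_le_one {x : A} (hx : x ∈ X) (u : A) :
    (relCayleyMinus 𝒜 X P).edist u (u * x) ≤ 1 := by
  rw [edist_le_one_iff_adj_or_eq, or_iff_not_imp_right]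
  exact fun h => ⟨h, Or.inl ⟨x, hx, Or.inl rfl⟩⟩

lemma relCayleyMinus_edist_mul_le_one_of_mem_subgroup {K : Subgroup A} (hK : K ∈ 𝒜) {k : A}
    (hk : k ∈ K) {u : A} (hu : ¬ (K = P ∧ u ∈ P)) :
    (relCayleyMinus 𝒜 X P).edist u (u * k) ≤ 1 := by
  rw [edist_le_one_iff_adj_or_eq, or_iff_not_imp_right]
  exact fun h => ⟨h, Or.inr ⟨K, hK, by simpa using hk, hu⟩⟩

lemma relCayleyMinus_adj_mul_left {g u v : A} (hg : g ∈ P)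
    (h : (relCayleyMinus 𝒜 X P).Adj u v) : (relCayleyMinus 𝒜 X P).Adj (g * u) (g * v) := by
  obtain ⟨hne, h⟩ := h
  refine ⟨by simpa using hne, ?_⟩
  rcases h with ⟨x, hx, rfl | rfl⟩ | ⟨K, hK, hm, hn⟩
  · exact Or.inl ⟨x, hx, Or.inl (mul_assoc _ _ _)⟩
  · exact Or.inl ⟨x, hx, Or.inr (mul_assoc _ _ _).symm⟩
  · refine Or.inr ⟨K, hK, by simpa [mul_assoc] using hm, fun h => hn ⟨h.1, ?_⟩⟩
    simpa using P.mul_mem (P.inv_mem hg) h.2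

lemma relCayleyMinus_edist_mul_left_le {g u v : A} (hg : g ∈ P) {n : ℕ}
    (h : (relCayleyMinus 𝒜 X P).edist u v ≤ n) :
    (relCayleyMinus 𝒜 X P).edist (g * u) (g * v) ≤ n := by
  simpa using edist_map_le (Γ' := relCayleyMinus 𝒜 X P) (f := (g * ·)) (m := 1) (fun x y hxy =>
    le_of_eq (edist_eq_one_iff_adj.2 (relCayleyMinus_adj_mul_left hg hxy))) h

lemma mulCayley_le_relCayleyMinus : mulCayley X ≤ relCayleyMinus 𝒜 X P := by
  intro u v h
  obtain ⟨hne, x, hx, h⟩ := (mulCayley_adj' X u v).1 h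
  exact ⟨hne, Or.inl ⟨x, hx, h⟩⟩

/-- The balls around `1` for the relative metrics of the members of `𝒜` are finite. -/
def RelLocallyFinite (𝒜 : Set (Subgroup A)) (X : Set A) : Prop :=
  ∀ P ∈ 𝒜, ∀ n : ℕ, {h ∈ (P : Set A) | (relCayleyMinus 𝒜 X P).edist 1 h ≤ n}.Finite

lemma RelLocallyFinite.ball_finite (hX : RelLocallyFinite 𝒜 X) (hP : P ∈ 𝒜) {p : A} (hp : p ∈ P)
    (n : ℕ) : {h ∈ (P : Set A) | (relCayleyMinus 𝒜 X P).edist p h ≤ n}.Finite := by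
  refine ((hX P hP n).image (p * ·)).subset ?_
  rintro h ⟨hh, hd⟩
  refine ⟨p⁻¹ * h, ⟨P.mul_mem (P.inv_mem hp) hh, ?_⟩, by simp⟩
  simpa using relCayleyMinus_edist_mul_left_le (P.inv_mem hp) hd

lemma hypEmbedded_iff : HypEmbedded 𝒜 X ↔
    Subgroup.closure (X ∪ ⋃ P ∈ 𝒜, (P : Set A)) = ⊤ ∧
    GraphHyperbolic (SimpleGraph.mulCayley (X ∪ ⋃ P ∈ 𝒜, (P : Set A))) ∧
    RelLocallyFinite 𝒜 X :=
  ⟨fun h => ⟨h.1, h.2.1, fun P hP n => h.2.2 P hP 1 P.one_mem n⟩,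
    fun h => ⟨h.1, h.2.1, fun _ hP _ hp n => h.2.2.ball_finite hP hp n⟩⟩

lemma RelLocallyFinite.of_edist_le {m : ℕ} (hX : RelLocallyFinite 𝒜 X)
    (hm : ∀ P ∈ 𝒜, ∀ u v, (relCayleyMinus 𝒜 Y P).Adj u v →
      (relCayleyMinus 𝒜 X P).edist u v ≤ m) : RelLocallyFinite 𝒜 Y := fun P hP n =>
  (hX P hP (m * n)).subset fun _ hh => ⟨hh.1, edist_map_le (f := id) (hm P hP) hh.2⟩

lemma relCayleyMinus_edist_le_of_generators {m : ℕ} (hm : 1 ≤ m) {Γ : SimpleGraph A}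
    (hΓ : relCayleyMinus 𝒜 X P ≤ Γ) (h : ∀ y ∈ Y, ∀ u, Γ.edist u (u * y) ≤ m) {u v : A}
    (huv : (relCayleyMinus 𝒜 Y P).Adj u v) : Γ.edist u v ≤ m := by
  obtain ⟨hne, ⟨y, hy, rfl | rfl⟩ | h'⟩ := huv
  · exact h y hy u
  · rw [SimpleGraph.edist_comm]; exact h y hy v
  · have : Γ.Adj u v := hΓ ⟨hne, Or.inr h'⟩
    rw [edist_eq_one_iff_adj.2 this]
    exact_mod_cast hm

/-- Enlarging `X` by elements of bounded word length in `X` preserves local finiteness. -/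
lemma RelLocallyFinite.union_of_edist_le {N : ℕ} (hX : RelLocallyFinite 𝒜 X)
    (hY : ∀ y ∈ Y, (mulCayley X).edist 1 y ≤ N) : RelLocallyFinite 𝒜 (X ∪ Y) := by
  refine hX.of_edist_le (m := N + 1) fun P _ u v => relCayleyMinus_edist_le_of_generators
    (by omega) le_rfl ?_
  rintro y (hy | hy) u
  · exact (relCayleyMinus_edist_mul_le_one hy u).trans (by simp)
  · refine (edist_anti mulCayley_le_relCayleyMinus).trans ?_
    have := (mulCayley_edist_mul_left X u 1 y).trans_le (hY y hy)
    rw [mul_one] at this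
    exact this.trans (by exact_mod_cast Nat.le_succ N)

lemma SimpleGraph.exists_of_edist_le_succ {V : Type*} {Γ : SimpleGraph V} {x y : V} {n : ℕ}
    (h : Γ.edist x y ≤ (n + 1 : ℕ)) : ∃ z, Γ.edist x z ≤ n ∧ (z = y ∨ Γ.Adj z y) := by
  obtain ⟨p, hp⟩ := exists_walk_length_le_of_edist_le h
  obtain ⟨q, hq⟩ : ∃ q : Γ.Walk y x, q.length ≤ n + 1 := ⟨p.reverse, by simpa using hp⟩
  cases q with
  | nil => exact ⟨x, by simp, Or.inl rfl⟩
  | @cons _ z _ hz q =>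
    refine ⟨z, ?_, Or.inr hz.symm⟩
    rw [SimpleGraph.edist_comm]
    rw [Walk.length_cons] at hq
    exact (edist_le q).trans (by exact_mod_cast (by omega : q.length ≤ n))

/-- The edges at vertices of `P` with a label in `B`. -/
def labelledEdges (P : Subgroup A) (B : Set A) : SimpleGraph A :=
  SimpleGraph.fromRel fun u v => u ∈ P ∧ u⁻¹ * v ∈ B

lemma labelledEdges_mono {B C : Set A} (h : B ⊆ C) : labelledEdges P B ≤ labelledEdges P C := by
  rintro u v ⟨hne, h' | h'⟩
  · exact ⟨hne, Or.inl ⟨h'.1, h h'.2⟩⟩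
  · exact ⟨hne, Or.inr ⟨h'.1, h h'.2⟩⟩

/-- An added B-edge has both ends in P. If it is the last edge of a path, it starts in P within n of
the previous finite set, so local finiteness leaves finitely many starting points, hence finitely
many endpoints, which join C. -/
lemma RelLocallyFinite.exists_cover (hX : RelLocallyFinite 𝒜 X) (hP : P ∈ 𝒜) {B : Set A}
    (hB : B.Finite) (hBP : B ⊆ P) (n : ℕ) :
    ∃ C : Set A, C.Finite ∧ C ⊆ P ∧ ∀ v, (relCayleyMinus 𝒜 X P ⊔ labelledEdges P B).edist 1 v ≤ n →
      ∃ a ∈ C, (relCayleyMinus 𝒜 X P).edist a v ≤ n := by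
  induction n with
  | zero =>
    refine ⟨{1}, Set.finite_singleton 1, by simp [P.one_mem], fun v hv => ⟨1, rfl, ?_⟩⟩
    have : 1 = v := by simpa using hv
    simp [this]
  | succ n ih =>
    obtain ⟨C, hCf, hCP, hC⟩ := ih
    let D : Set A := ⋃ a ∈ C, {h ∈ (P : Set A) | (relCayleyMinus 𝒜 X P).edist a h ≤ n}
    have hDf : D.Finite := hCf.biUnion fun a ha => hX.ball_finite hP (hCP ha) n
    refine ⟨C ∪ D * (B ∪ B⁻¹), hCf.union (hDf.mul (hB.union hB.inv)), ?_, fun v hv => ?_⟩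
    · rintro x (hx | ⟨d, hd, b, hb, rfl⟩)
      · exact hCP hx
      · obtain ⟨a, -, hd⟩ := Set.mem_iUnion₂.1 hd
        refine P.mul_mem hd.1 ?_
        rcases hb with hb | hb
        · exact hBP hb
        · exact P.inv_mem_iff.1 (hBP hb)
    · obtain ⟨z, hz, hzv⟩ := exists_of_edist_le_succ hv
      obtain ⟨a, ha, haz⟩ := hC z hz
      rcases hzv with rfl | hzv | hzv
      · exact ⟨a, Or.inl ha, haz.trans (by exact_mod_cast Nat.le_succ n)⟩
      · exact ⟨a, Or.inl ha, edist_le_add haz (n := 1) (edist_eq_one_iff_adj.2 hzv).le⟩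
      · refine ⟨v, Or.inr ?_, by simp⟩
        have hzP : z ∈ P := by
          rcases hzv.2 with h | h
          · exact h.1
          · simpa using P.mul_mem h.1 (hBP h.2)
        refine ⟨z, Set.mem_iUnion₂.2 ⟨a, ha, hzP, haz⟩, z⁻¹ * v, ?_, by simp⟩
        rcases hzv.2 with h | h
        · exact Or.inl h.2
        · exact Or.inr (by simpa using h.2)

/-- Spell f as a word. A letter traces a removed edge only if it lies in P and is read at a vertex
of P. The finitely many letters in P form B, independently of u. -/
lemma exists_labelled_edist_le (P : Subgroup A) {f : A}
    (hf : f ∈ Subgroup.closure (X ∪ ⋃ K ∈ 𝒜, (K : Set A))) :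
    ∃ (B : Set A) (m : ℕ), B.Finite ∧ B ⊆ P ∧
      ∀ u, (relCayleyMinus 𝒜 X P ⊔ labelledEdges P B).edist u (u * f) ≤ m := by
  induction hf using Subgroup.closure_induction with
  | one => exact ⟨∅, 0, Set.finite_empty, by simp, by simp⟩
  | mem x hx =>
    rcases hx with hx | hx
    · exact ⟨∅, 1, Set.finite_empty, by simp, fun u =>
        (edist_anti le_sup_left).trans (relCayleyMinus_edist_mul_le_one hx u)⟩
    · obtain ⟨K, hK, hx⟩ := Set.mem_iUnion₂.1 hx
      refine ⟨{x} ∩ (P : Set A), 1, (Set.finite_singleton x).inter_of_left _,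
        Set.inter_subset_right, fun u => ?_⟩
      by_cases hu : K = P ∧ u ∈ P
      · obtain ⟨rfl, hu⟩ := hu
        refine (edist_anti le_sup_right).trans ?_
        rw [Nat.cast_one, edist_le_one_iff_adj_or_eq, or_iff_not_imp_right]
        exact fun hne => ⟨hne, Or.inl ⟨hu, by simpa using hx⟩⟩
      · exact (edist_anti le_sup_left).trans
          (relCayleyMinus_edist_mul_le_one_of_mem_subgroup hK hx hu)
  | mul x y _ _ hx hy =>
    obtain ⟨B, m, hB, hBP, h⟩ := hx
    obtain ⟨C, n, hC, hCP, h'⟩ := hy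
    refine ⟨B ∪ C, m + n, hB.union hC, Set.union_subset hBP hCP, fun u => ?_⟩
    rw [← mul_assoc]
    exact edist_le_add
      ((edist_anti (sup_le_sup_left (labelledEdges_mono Set.subset_union_left) _)).trans (h u))
      ((edist_anti (sup_le_sup_left (labelledEdges_mono Set.subset_union_right) _)).trans (h' _))
  | inv x _ hx =>
    obtain ⟨B, m, hB, hBP, h⟩ := hx
    refine ⟨B, m, hB, hBP, fun u => ?_⟩
    rw [SimpleGraph.edist_comm]
    simpa using h (u * x⁻¹)

lemma exists_labelled_edist_le_of_finite (hX : Subgroup.closure (X ∪ ⋃ K ∈ 𝒜, (K : Set A)) = ⊤)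
    (P : Subgroup A) {F : Set A} (hF : F.Finite) :
    ∃ (B : Set A) (m : ℕ), B.Finite ∧ B ⊆ P ∧
      ∀ f ∈ F, ∀ u, (relCayleyMinus 𝒜 X P ⊔ labelledEdges P B).edist u (u * f) ≤ m := by
  have hex : ∀ f : A, _ := fun f =>
    exists_labelled_edist_le (𝒜 := 𝒜) (X := X) P (f := f) (by simp [hX])
  choose B m hB hBP h using hex
  obtain ⟨M, hM⟩ := (hF.image m).bddAbove
  refine ⟨⋃ f ∈ F, B f, M, hF.biUnion fun f _ => hB f, Set.iUnion₂_subset fun f _ => hBP f,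
    fun f hf u => ?_⟩
  refine (edist_anti (sup_le_sup_left (labelledEdges_mono ?_) _)).trans ((h f u).trans ?_)
  · exact Set.subset_biUnion_of_mem (u := B) hf
  · exact_mod_cast hM ⟨f, hf, rfl⟩

/-- Enlarging `X` by a finite set preserves local finiteness of the relative metrics. -/
theorem RelLocallyFinite.union_finite (hX : RelLocallyFinite 𝒜 X)
    (hgen : Subgroup.closure (X ∪ ⋃ K ∈ 𝒜, (K : Set A)) = ⊤) {F : Set A} (hF : F.Finite) :
    RelLocallyFinite 𝒜 (X ∪ F) := by
  intro P hP n
  obtain ⟨B, m, hB, hBP, hm⟩ := exists_labelled_edist_le_of_finite hgen P hF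
  obtain ⟨C, hC, hCP, hcov⟩ := hX.exists_cover hP hB hBP ((m + 1) * n)
  refine (hC.biUnion fun a ha => hX.ball_finite hP (hCP ha) ((m + 1) * n)).subset ?_
  rintro h ⟨hhP, hh⟩
  have hY : ∀ y ∈ X ∪ F, ∀ u,
      (relCayleyMinus 𝒜 X P ⊔ labelledEdges P B).edist u (u * y) ≤ (m + 1 : ℕ) := by
    rintro y (hy | hy) u
    · exact (edist_anti le_sup_left).trans ((relCayleyMinus_edist_mul_le_one hy u).trans (by simp))
    · exact (hm y hy u).trans (by exact_mod_cast Nat.le_succ m)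
  obtain ⟨a, ha, hah⟩ := hcov h (edist_map_le (f := id) (fun u v huv =>
    relCayleyMinus_edist_le_of_generators (by omega) le_sup_left hY huv) hh)
  exact Set.mem_iUnion₂.2 ⟨a, ha, hhP, hah⟩

/-- The members of `𝒜` form an almost malnormal collection. -/
theorem RelLocallyFinite.eq_and_mem_of_infinite (hX : RelLocallyFinite 𝒜 X)
    (hgen : Subgroup.closure (X ∪ ⋃ K ∈ 𝒜, (K : Set A)) = ⊤) {Q Q' : Subgroup A} (hQ : Q ∈ 𝒜)
    (hQ' : Q' ∈ 𝒜) {g : A} (hinf : {x | x ∈ Q ∧ g⁻¹ * x * g ∈ Q'}.Infinite) : Q' = Q ∧ g ∈ Q := by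
  by_contra hne
  -- The path 1, g, xg, x has length 3. Its middle edge is labelled by Q' and starts at g, so it is
  -- kept unless Q' = Q and g ∈ Q.
  refine hinf ((hX.union_finite hgen (Set.toFinite {g, g⁻¹}) Q hQ 3).subset ?_)
  rintro x ⟨hxQ, hx⟩
  refine ⟨hxQ, ?_⟩
  have h1 : (relCayleyMinus 𝒜 (X ∪ {g, g⁻¹}) Q).edist 1 (1 * g) ≤ (1 : ℕ) :=
    relCayleyMinus_edist_mul_le_one (by simp) 1
  have h2 : (relCayleyMinus 𝒜 (X ∪ {g, g⁻¹}) Q).edist (1 * g) (1 * g * (g⁻¹ * x * g)) ≤ (1 : ℕ) :=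
    relCayleyMinus_edist_mul_le_one_of_mem_subgroup hQ' hx (by simpa using hne)
  have h3 : (relCayleyMinus 𝒜 (X ∪ {g, g⁻¹}) Q).edist (1 * g * (g⁻¹ * x * g))
      (1 * g * (g⁻¹ * x * g) * g⁻¹) ≤ (1 : ℕ) :=
    relCayleyMinus_edist_mul_le_one (by simp) _
  have := edist_le_add (edist_le_add h1 h2) h3
  rwa [show 1 * g * (g⁻¹ * x * g) * g⁻¹ = x by group] at this

/-- Enlarging `X` by a finite set preserves hyperbolic embeddedness. -/
theorem HypEmbedded.union_finite (hX : HypEmbedded 𝒜 X) {F : Set A} (hF : F.Finite) :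
    HypEmbedded 𝒜 (X ∪ F) := by
  rw [hypEmbedded_iff] at hX ⊢
  obtain ⟨hgen, hhyp, hfin⟩ := hX
  have hsub : X ∪ ⋃ P ∈ 𝒜, (P : Set A) ⊆ X ∪ F ∪ ⋃ P ∈ 𝒜, (P : Set A) :=
    Set.union_subset_union_left _ Set.subset_union_left
  have hgen' : Subgroup.closure (X ∪ F ∪ ⋃ P ∈ 𝒜, (P : Set A)) = ⊤ :=
    top_le_iff.1 (hgen ▸ Subgroup.closure_mono hsub)
  refine ⟨hgen', ?_, hfin.union_finite hgen hF⟩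
  have hc := mulCayley_connected hgen
  have hc' := mulCayley_connected hgen'
  obtain ⟨M, hM⟩ := (hF.image fun f =>
    (mulCayley (X ∪ ⋃ P ∈ 𝒜, (P : Set A))).dist 1 f).bddAbove
  refine hhyp.of_coarseRetract hc hc' (f := id) (g := id) (A := M + 1) (fun u v huv => ?_)
    (dist_le_of_mulCayley_adj ?_) (by simp)
  · have : (mulCayley (X ∪ F ∪ ⋃ P ∈ 𝒜, (P : Set A))).Adj u v := mulCayley_mono hsub huv
    rw [id, id, dist_eq_one_iff_adj.2 this]
    omega
  · intro s hs u
    by_cases hsF : s ∈ F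
    · have h1 := mulCayley_dist_mul_left (X ∪ ⋃ P ∈ 𝒜, (P : Set A)) u 1 s
      have h2 : (mulCayley (X ∪ ⋃ P ∈ 𝒜, (P : Set A))).dist 1 s ≤ M := hM ⟨s, hsF, rfl⟩
      rw [mul_one] at h1
      simp only [id]
      omega
    · have hs' : s ∈ X ∪ ⋃ P ∈ 𝒜, (P : Set A) := by
        rcases hs with (hs | hs) | hs
        · exact Or.inl hs
        · exact absurd hs hsF
        · exact Or.inr hs
      have := hc.edist_le_iff.1 (mulCayley_edist_mul_le_one hs' u)
      simp only [id]
      omega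

end RelativeMetric

/-! ### Almost malnormal collections -/

/-- Distinct conjugates of the members of `𝒜` have finite intersection, and the members of `𝒜` are
self-normalizing. -/
def IsAlmostMalnormal {A : Type*} [Group A] (𝒜 : Set (Subgroup A)) : Prop :=
  ∀ Q ∈ 𝒜, ∀ Q' ∈ 𝒜, ∀ g : A, {x | x ∈ Q ∧ g⁻¹ * x * g ∈ Q'}.Infinite → Q' = Q ∧ g ∈ Q

lemma HypEmbedded.isAlmostMalnormal {A : Type*} [Group A] {𝒜 : Set (Subgroup A)} {X : Set A}
    (h : HypEmbedded 𝒜 X) : IsAlmostMalnormal 𝒜 := fun _ hQ _ hQ' _ hinf =>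
  (hypEmbedded_iff.1 h).2.2.eq_and_mem_of_infinite h.1 hQ hQ' hinf

lemma Subgroup.mem_conj_smul_iff {A : Type*} [Group A] {Q : Subgroup A} {g x : A} :
    x ∈ MulAut.conj g • Q ↔ g⁻¹ * x * g ∈ Q := by
  rw [Subgroup.mem_pointwise_smul_iff_inv_smul_mem, ← map_inv, MulAut.smul_def, MulAut.conj_apply,
    inv_inv]

section ConjugateSubgroups

variable {A : Type*} [Group A] {𝒜 : Set (Subgroup A)}

lemma IsAlmostMalnormal.eq_of_infinite (h : IsAlmostMalnormal 𝒜) {K K' : Subgroup A}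
    (hK : K ∈ conjugateSubgroups 𝒜) (hK' : K' ∈ conjugateSubgroups 𝒜)
    (hinf : {x | x ∈ K ∧ x ∈ K'}.Infinite) : K = K' := by
  obtain ⟨Q, hQ, a, rfl⟩ := hK
  obtain ⟨Q', hQ', b, rfl⟩ := hK'
  obtain ⟨rfl, hab⟩ := h Q hQ Q' hQ' (a⁻¹ * b) (by
    refine (hinf.image (f := fun x => a⁻¹ * x * a) fun x _ y _ hxy => by simpa using hxy).mono ?_
    rintro _ ⟨x, ⟨hx, hx'⟩, rfl⟩
    rw [Subgroup.mem_conj_smul_iff] at hx hx'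
    exact ⟨hx, by simpa [mul_assoc] using hx'⟩)
  ext x
  rw [Subgroup.mem_conj_smul_iff, Subgroup.mem_conj_smul_iff,
    show b⁻¹ * x * b = (a⁻¹ * b)⁻¹ * (a⁻¹ * x * a) * (a⁻¹ * b) by group,
    Subgroup.mul_mem_cancel_right _ hab, Subgroup.mul_mem_cancel_left _ (inv_mem hab)]

lemma infinite_of_mem_conjugateSubgroups (hinf : ∀ Q ∈ 𝒜, Infinite Q) {K : Subgroup A}
    (hK : K ∈ conjugateSubgroups 𝒜) : Infinite K := by
  obtain ⟨Q, hQ, a, rfl⟩ := hK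
  have := hinf Q hQ
  exact (Subgroup.equivSMul (MulAut.conj a) Q).toEquiv.infinite_iff.1 this

lemma IsAlmostMalnormal.mem_of_conj_smul_eq (h : IsAlmostMalnormal 𝒜)
    (hinf : ∀ Q ∈ 𝒜, Infinite Q) {K : Subgroup A} (hK : K ∈ conjugateSubgroups 𝒜) {g : A}
    (hg : MulAut.conj g • K = K) : g ∈ K := by
  obtain ⟨Q, hQ, a, rfl⟩ := hK
  rw [Subgroup.mem_conj_smul_iff]
  refine (h Q hQ Q hQ _ ?_).2
  refine (Set.infinite_coe_iff.1 (hinf Q hQ)).mono fun x hx => ⟨hx, ?_⟩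
  have hx' : a * x * a⁻¹ ∈ MulAut.conj g • MulAut.conj a • Q := by
    rw [hg, Subgroup.mem_conj_smul_iff]
    simpa [mul_assoc] using hx
  rw [Subgroup.mem_conj_smul_iff, Subgroup.mem_conj_smul_iff] at hx'
  simpa [mul_assoc] using hx'

end ConjugateSubgroups

/-! ### Commensurators and refinements in the overgroup -/

section Normal

variable {G : Type*} [Group G] {H : Subgroup G} [H.Normal] {𝒬 : Set (Subgroup H)}

lemma Subgroup.mem_conjNormal_smul_iff {K : Subgroup H} {g : G} {x : H} :
    x ∈ (MulAut.conjNormal g : MulAut H) • K ↔ MulAut.conjNormal g⁻¹ x ∈ K := by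
  rw [Subgroup.mem_pointwise_smul_iff_inv_smul_mem, ← map_inv, MulAut.smul_def]

lemma Subgroup.map_subtype_conjNormal_smul (K : Subgroup H) (g : G) :
    ((MulAut.conjNormal g : MulAut H) • K).map H.subtype = MulAut.conj g • K.map H.subtype := by
  ext x
  rw [Subgroup.mem_conj_smul_iff]
  constructor
  · rintro ⟨y, hy, rfl⟩
    exact ⟨_, Subgroup.mem_conjNormal_smul_iff.1 hy, by simp⟩
  · rintro ⟨y, hy, hyx⟩
    refine ⟨MulAut.conjNormal g y, Subgroup.smul_mem_pointwise_smul _ _ _ hy, ?_⟩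
    rw [Subgroup.subtype_apply] at hyx
    rw [Subgroup.subtype_apply, MulAut.conjNormal_apply, hyx]
    group

lemma conjNormal_coe_smul (h : H) (K : Subgroup H) :
    (MulAut.conjNormal (h : G) : MulAut H) • K = MulAut.conj h • K := by
  rw [MulAut.conjNormal_val]

lemma Subgroup.infinite_inf_of_relIndex_ne_zero {A : Type*} [Group A] {K L : Subgroup A}
    [Infinite L] (h : K.relIndex L ≠ 0) : Infinite (K.subgroupOf L) := by
  by_contra hfin
  rw [not_infinite_iff_finite] at hfin
  have : (K.subgroupOf L).FiniteIndex := ⟨h⟩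
  have : Finite L := Finite.of_equiv _ (K.subgroupOf L).groupEquivQuotientProdSubgroup.symm
  exact not_finite L

lemma toConjAct_smul_eq {A : Type*} [Group A] (g : A) (K : Subgroup A) :
    ConjAct.toConjAct g • K = MulAut.conj g • K := by
  ext x
  rw [Subgroup.mem_conj_smul_iff, Subgroup.mem_pointwise_smul_iff_inv_smul_mem, ← map_inv,
    ConjAct.toConjAct_smul, inv_inv]

/-- If g commensurates K, then K and gKg⁻¹ have infinite intersection; both are H-conjugates of
members of 𝒬, so almost malnormality makes them equal. -/
lemma IsAlmostMalnormal.mem_commensurator_iff (h : IsAlmostMalnormal 𝒬)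
    (hinf : ∀ Q ∈ 𝒬, Infinite Q)
    (hinv : ∀ g : G, ∀ K ∈ conjugateSubgroups 𝒬,
      (MulAut.conjNormal g : MulAut H) • K ∈ conjugateSubgroups 𝒬)
    {K : Subgroup H} (hK : K ∈ conjugateSubgroups 𝒬) {g : G} :
    g ∈ Subgroup.Commensurable.commensurator (K.map H.subtype) ↔
      (MulAut.conjNormal g : MulAut H) • K = K := by
  rw [Subgroup.Commensurable.commensurator_mem_iff, toConjAct_smul_eq,
    ← Subgroup.map_subtype_conjNormal_smul]
  refine ⟨fun hc => ?_, fun hg => hg.symm ▸ Subgroup.Commensurable.refl _⟩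
  have hKinf := infinite_of_mem_conjugateSubgroups hinf hK
  have : Infinite (K.map H.subtype) :=
    (K.equivMapOfInjective _ H.subtype_injective).toEquiv.infinite_iff.1 hKinf
  have hI := Subgroup.infinite_inf_of_relIndex_ne_zero hc.1
  refine h.eq_of_infinite (hinv g K hK) hK fun hfin => ?_
  have hfin' : ((fun x : H => (x : G)) '' {x | x ∈ (MulAut.conjNormal g : MulAut H) • K ∧
      x ∈ K}).Finite := hfin.image _
  refine (Set.infinite_coe_iff.1 hI) (Set.Finite.of_finite_image (hfin'.subset ?_)
    (f := fun x : K.map H.subtype => (x : G)) Subtype.coe_injective.injOn)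
  rintro _ ⟨⟨_, x, hx, rfl⟩, hx', rfl⟩
  obtain ⟨y, hy, hyx⟩ := Subgroup.mem_subgroupOf.1 hx'
  obtain rfl := H.subtype_injective hyx
  exact ⟨y, ⟨hy, hx⟩, rfl⟩

/-- The subgroups `P ∈ 𝒮` of `G` meet `H` in conjugates of the members of `𝒬`, and every
such conjugate corresponds to exactly one coset of exactly one member of `𝒮`. -/
structure IsPeripheralExtension (𝒬 : Set (Subgroup H)) (𝒮 : Set (Subgroup G)) : Prop where
  finite : 𝒮.Finite
  subgroupOf_mem : ∀ P ∈ 𝒮, P.subgroupOf H ∈ conjugateSubgroups 𝒬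
  eq_and_mem : ∀ P ∈ 𝒮, ∀ P' ∈ 𝒮, ∀ u : G,
    (MulAut.conjNormal u : MulAut H) • P'.subgroupOf H = P.subgroupOf H → P' = P ∧ u ∈ P
  exists_conj_le : ∀ Q ∈ 𝒬, ∃ P ∈ 𝒮, ∃ g : G, ∀ q ∈ Q, g * q * g⁻¹ ∈ P

/-- Each P ∈ 𝒮 is the normalizer of P ∩ H, so an element carrying P' ∩ H to P ∩ H conjugates P' to
P. Uniqueness of representatives gives P' = P, and the element then normalizes P ∩ H. Finiteness
holds because each Q accounts for at most one P. -/
lemma IsAlmostMalnormal.isPeripheralExtension (h : IsAlmostMalnormal 𝒬) (hfin : 𝒬.Finite)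
    (hinf : ∀ Q ∈ 𝒬, Infinite Q)
    (hinv : ∀ g : G, ∀ K ∈ conjugateSubgroups 𝒬,
      (MulAut.conjNormal g : MulAut H) • K ∈ conjugateSubgroups 𝒬)
    {𝒮 : Set (Subgroup G)} (h𝒮 : IsRefinement ((fun Q => Q.map H.subtype) '' 𝒬) 𝒮) :
    IsPeripheralExtension 𝒬 𝒮 := by
  have hself : ∀ Q ∈ 𝒬, Q ∈ conjugateSubgroups 𝒬 := fun Q hQ => ⟨Q, hQ, 1, by simp⟩
  have hsub : ∀ K ∈ conjugateSubgroups 𝒬,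
      (Subgroup.Commensurable.commensurator (K.map H.subtype)).subgroupOf H = K := by
    intro K hK
    ext x
    rw [Subgroup.mem_subgroupOf, h.mem_commensurator_iff hinf hinv hK, conjNormal_coe_smul]
    exact ⟨h.mem_of_conj_smul_eq hinf hK, fun hx => Subgroup.conj_smul_eq_self_of_mem hx⟩
  have hrep : ∀ P ∈ 𝒮, ∃ Q ∈ 𝒬, ∃ g : G,
      P.subgroupOf H = (MulAut.conjNormal g : MulAut H) • Q ∧
      P = Subgroup.Commensurable.commensurator ((P.subgroupOf H).map H.subtype) := by
    intro P hP
    obtain ⟨_, ⟨Q, hQ, rfl⟩, g, hPg⟩ := h𝒮.1 hP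
    simp only [← Subgroup.map_subtype_conjNormal_smul] at hPg
    have := hsub _ (hinv g Q (hself Q hQ))
    rw [← hPg] at this
    exact ⟨Q, hQ, g, this, by rw [this, ← hPg]⟩
  have hmem : ∀ P ∈ 𝒮, P.subgroupOf H ∈ conjugateSubgroups 𝒬 := by
    intro P hP
    obtain ⟨Q, hQ, g, hPg, -⟩ := hrep P hP
    exact hPg ▸ hinv g Q (hself Q hQ)
  have hiff : ∀ P ∈ 𝒮, ∀ g, g ∈ P ↔
      (MulAut.conjNormal g : MulAut H) • P.subgroupOf H = P.subgroupOf H := by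
    intro P hP g
    obtain ⟨Q, hQ, _, -, hPK⟩ := hrep P hP
    rw [← h.mem_commensurator_iff hinf hinv (hmem P hP), ← hPK]
  have huniq : ∀ P ∈ 𝒮, ∀ P' ∈ 𝒮, ∀ u : G,
      (MulAut.conjNormal u : MulAut H) • P'.subgroupOf H = P.subgroupOf H → P' = P ∧ u ∈ P := by
    intro P hP P' hP' u hu
    have hconj : P = MulAut.conj u • P' := by
      ext g
      rw [hiff P hP, Subgroup.mem_conj_smul_iff, hiff P' hP', ← hu, map_mul, map_mul, mul_smul,
        mul_smul, map_inv, inv_smul_eq_iff]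
    obtain rfl := (h𝒮.2 P' (h𝒮.1 hP')).unique ⟨hP', 1, by simp⟩ ⟨hP, u, hconj⟩
    exact ⟨rfl, (hiff _ hP u).2 hu⟩
  refine ⟨?_, hmem, huniq, fun Q hQ => ?_⟩
  · refine (hfin.biUnion (t := fun Q => {P ∈ 𝒮 | ∃ g : G, P.subgroupOf H =
      (MulAut.conjNormal g : MulAut H) • Q}) fun Q _ => Set.Subsingleton.finite ?_).subset
      fun P hP => ?_
    · rintro P ⟨hP, g, hg⟩ P' ⟨hP', g', hg'⟩
      refine (huniq P' hP' P hP (g' * g⁻¹) ?_).1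
      rw [hg, hg', map_mul, mul_smul, map_inv, inv_smul_smul]
    · obtain ⟨Q, hQ, g, hg, -⟩ := hrep P hP
      exact Set.mem_iUnion₂.2 ⟨Q, hQ, hP, g, hg⟩
  · obtain ⟨P, ⟨hP, g, hPg⟩, -⟩ := h𝒮.2 (Subgroup.Commensurable.commensurator (Q.map H.subtype))
      ⟨_, ⟨Q, hQ, rfl⟩, 1, by simp⟩
    refine ⟨P, hP, g, fun q hq => ?_⟩
    rw [hPg, Subgroup.mem_conj_smul_iff]
    have : q ∈ (Subgroup.Commensurable.commensurator (Q.map H.subtype)).subgroupOf H := by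
      rwa [hsub Q (hself Q hQ)]
    simpa [mul_assoc] using Subgroup.mem_subgroupOf.1 this

/-! ### Images of peripheral edges under the retraction to H -/

lemma Subgroup.exists_finite_representatives (H P : Subgroup G) [H.FiniteIndex] :
    ∃ S : Set G, S.Finite ∧ S ⊆ P ∧ ∀ p ∈ P, ∃ s ∈ S, p * s⁻¹ ∈ H := by
  obtain ⟨S, hS, hbij⟩ := (P : Set G).exists_subset_bijOn
    (fun p => (QuotientGroup.mk p⁻¹ : G ⧸ H))
  refine ⟨S, hbij.finite_iff_finite.2 (Set.toFinite _), hS, fun p hp => ?_⟩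
  obtain ⟨s, hs, hsp⟩ := hbij.surjOn ⟨p, hp, rfl⟩
  refine ⟨s, hs, ?_⟩
  simpa using QuotientGroup.eq.1 hsp.symm

/-- Write p = xs with x ∈ P ∩ H and s in a finite set. Since rxr⁻¹ = kqk⁻¹, equivariance gives f =
k⁻¹ρ(rs). -/
lemma exists_finite_coset_labels [H.FiniteIndex] {ρ : G → H}
    (hρ : ∀ (h : H) (x : G), ρ (h * x) = h * ρ x) {P : Subgroup G}
    (hinv : ∀ g : G, ∀ K ∈ conjugateSubgroups 𝒬,
      (MulAut.conjNormal g : MulAut H) • K ∈ conjugateSubgroups 𝒬)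
    (hP : P.subgroupOf H ∈ conjugateSubgroups 𝒬) (r : G) :
    ∃ F : Set H, F.Finite ∧ ∀ p ∈ P, ∃ k ∈ F, ∃ f ∈ F, ∃ Q ∈ 𝒬, ∃ q ∈ Q,
      MulAut.conj k • Q = (MulAut.conjNormal r : MulAut H) • P.subgroupOf H ∧
        ρ (r * p) = k * q * f := by
  obtain ⟨Q, hQ, k, hk⟩ := hinv r _ hP
  obtain ⟨S, hS, hSP, hrep⟩ := Subgroup.exists_finite_representatives H P
  refine ⟨insert k ((fun s => k⁻¹ * ρ (r * s)) '' S), (hS.image _).insert k, fun p hp => ?_⟩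
  obtain ⟨s, hs, hps⟩ := hrep p hp
  have hx : (MulAut.conjNormal r ⟨p * s⁻¹, hps⟩ : H) ∈ MulAut.conj k • Q := by
    rw [← hk]
    exact Subgroup.smul_mem_pointwise_smul _ _ _
      (Subgroup.mem_subgroupOf.2 (P.mul_mem hp (P.inv_mem (hSP hs))))
  refine ⟨k, Set.mem_insert _ _, _, Set.mem_insert_of_mem _ ⟨s, hs, rfl⟩, Q, hQ, _,
    Subgroup.mem_conj_smul_iff.1 hx, hk.symm, ?_⟩
  have : r * p = (MulAut.conjNormal r ⟨p * s⁻¹, hps⟩ : H) * (r * s) := by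
    rw [MulAut.conjNormal_apply]
    group
  rw [this, hρ]
  group

variable {𝒮 : Set (Subgroup G)} {T : Set H} {R : Set G}

/-- By equivariance only the R-part of u matters, so finitely many pairs (P, r) suffice. The
identity of conjugates remembers which coset the Q-edge lies in; it later separates kept from
removed edges. -/
lemma IsPeripheralExtension.exists_finite_labels [H.FiniteIndex]
    (h𝒮 : IsPeripheralExtension 𝒬 𝒮)
    (hinv : ∀ g : G, ∀ K ∈ conjugateSubgroups 𝒬,
      (MulAut.conjNormal g : MulAut H) • K ∈ conjugateSubgroups 𝒬)
    {ρ : G → H} (hρ : ∀ (h : H) (x : G), ρ (h * x) = h * ρ x) (hR : R.Finite)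
    (hρR : ∀ x, ((ρ x : G))⁻¹ * x ∈ R) :
    ∃ F : Set H, F.Finite ∧ (∀ u, ∀ x ∈ R, (ρ u)⁻¹ * ρ (u * x) ∈ F) ∧
      ∀ P ∈ 𝒮, ∀ u, ∀ p ∈ P, ∃ k ∈ F, ∃ f ∈ F, ∃ Q ∈ 𝒬, ∃ q ∈ Q,
        MulAut.conj (ρ u * k) • Q = (MulAut.conjNormal u : MulAut H) • P.subgroupOf H ∧
          ρ (u * p) = ρ u * k * q * f := by
  have hex : ∀ (P : Subgroup G) (r : G), ∃ F : Set H, F.Finite ∧ (P ∈ 𝒮 → ∀ p ∈ P, ∃ k ∈ F,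
      ∃ f ∈ F, ∃ Q ∈ 𝒬, ∃ q ∈ Q,
      MulAut.conj k • Q = (MulAut.conjNormal r : MulAut H) • P.subgroupOf H ∧
        ρ (r * p) = k * q * f) := by
    intro P r
    by_cases hP : P ∈ 𝒮
    · obtain ⟨F, hF, h⟩ := exists_finite_coset_labels hρ hinv (h𝒮.subgroupOf_mem P hP) r
      exact ⟨F, hF, fun _ => h⟩
    · exact ⟨∅, Set.finite_empty, fun h => absurd h hP⟩
  choose F hF h using hex
  have hu : ∀ u x, ρ (u * x) = ρ u * ρ ((ρ u : G)⁻¹ * u * x) := fun u x => by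
    rw [← hρ]; group
  refine ⟨(ρ '' (R * R)) ∪ ⋃ P ∈ 𝒮, ⋃ r ∈ R, F P r, ((hR.mul hR).image ρ).union
    (h𝒮.finite.biUnion fun P _ => hR.biUnion fun r _ => hF P r), fun u x hx => Or.inl ?_,
    fun P hP u p hp => ?_⟩
  · exact ⟨_, Set.mul_mem_mul (hρR u) hx, by rw [hu u x, inv_mul_cancel_left]⟩
  · have hsub : F P ((ρ u : G)⁻¹ * u) ⊆ (ρ '' (R * R)) ∪ ⋃ P ∈ 𝒮, ⋃ r ∈ R, F P r := fun x hx =>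
      Or.inr (Set.mem_iUnion₂.2 ⟨P, hP, Set.mem_iUnion₂.2 ⟨_, hρR u, hx⟩⟩)
    obtain ⟨k, hk, f, hf, Q, hQ, q, hq, h1, h2⟩ := h P ((ρ u : G)⁻¹ * u) hP p hp
    refine ⟨k, hsub hk, f, hsub hf, Q, hQ, q, hq, ?_, ?_⟩
    · rw [map_mul, mul_smul, h1, ← conjNormal_coe_smul, ← mul_smul, ← map_mul,
        mul_inv_cancel_left]
    · rw [hu, h2]
      simp only [mul_assoc]

lemma conjNormal_rho {ρ : G → H} (hρ : ∀ (h : H) (x : G), ρ (h * x) = h * ρ x) (u : G) (t : H) :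
    ρ (u * t) = ρ u * MulAut.conjNormal ((ρ u : G)⁻¹ * u) t := by
  have : u * t = (ρ u * MulAut.conjNormal ((ρ u : G)⁻¹ * u) t * (ρ u)⁻¹ : H) * u := by
    push_cast
    rw [MulAut.conjNormal_apply]
    group
  rw [this, hρ]
  group

end Normal

lemma mulCayley_dist_mul_right {A : Type*} [Group A] (S : Set A) (u x : A) :
    (mulCayley S).dist u (u * x) = (mulCayley S).dist 1 x := by
  simpa using mulCayley_dist_mul_left S u 1 x

lemma Subgroup.IsComplement.exists_retraction {G : Type*} [Group G] {H : Subgroup G} {R : Set G}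
    (hR : Subgroup.IsComplement (H : Set G) R) :
    ∃ ρ : G → H, (∀ (h : H) (x : G), ρ (h * x) = h * ρ x) ∧ ∀ x, ((ρ x : G))⁻¹ * x ∈ R := by
  have hex : ∀ x : G, ∃ h : H, (h : G)⁻¹ * x ∈ R := fun x => by
    obtain ⟨⟨h, r⟩, hhr, -⟩ := hR.existsUnique x
    exact ⟨h, by rw [← hhr]; simp⟩
  choose ρ hρ using hex
  refine ⟨ρ, fun h x => ?_, hρ⟩
  have := (hR.existsUnique (h * x)).unique
    (y₁ := (⟨ρ (h * x), (ρ (h * x)).2⟩, ⟨_, hρ (h * x)⟩))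
    (y₂ := (⟨(h * ρ x : H), (h * ρ x : H).2⟩, ⟨_, hρ x⟩)) (by simp) (by simp [mul_assoc])
  exact Subtype.ext (congrArg (fun y => (y.1 : G)) this)

/-! ### Hyperbolicity of the relative Cayley graph of G -/

section Normal

variable {G : Type*} [Group G] {H : Subgroup G} [H.Normal] {𝒬 : Set (Subgroup H)}
  {𝒮 : Set (Subgroup G)} {T : Set H} {R : Set G}

/-- An edge q ∈ Q becomes g⁻¹ · gqg⁻¹ · g with gqg⁻¹ ∈ P, and one g serves each of the finitely many
Q. -/
lemma IsPeripheralExtension.exists_dist_coe_le (h𝒮 : IsPeripheralExtension 𝒬 𝒮)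
    (h𝒬 : 𝒬.Finite)
    (hgen : Subgroup.closure (((↑) '' T : Set G) ∪ R ∪ ⋃ P ∈ 𝒮, (P : Set G)) = ⊤) :
    ∃ A : ℕ, ∀ u v : H, (mulCayley (T ∪ ⋃ Q ∈ 𝒬, (Q : Set H))).Adj u v →
      (mulCayley (((↑) '' T : Set G) ∪ R ∪ ⋃ P ∈ 𝒮, (P : Set G))).dist (u : G) v ≤ A := by
  have hc := mulCayley_connected hgen
  set S : Set G := ((↑) '' T : Set G) ∪ R ∪ ⋃ P ∈ 𝒮, (P : Set G) with hS
  have hex : ∀ Q : Subgroup H, ∃ g : G, Q ∈ 𝒬 → ∃ P ∈ 𝒮, ∀ q ∈ Q, g * q * g⁻¹ ∈ P := fun Q => by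
    by_cases hQ : Q ∈ 𝒬
    · obtain ⟨P, hP, g, hg⟩ := h𝒮.exists_conj_le Q hQ
      exact ⟨g, fun _ => ⟨P, hP, hg⟩⟩
    · exact ⟨1, fun h => absurd h hQ⟩
  choose g hg using hex
  obtain ⟨B, hB⟩ := (h𝒬.image fun Q => (mulCayley S).dist 1 (g Q)).bddAbove
  refine ⟨B + 1 + B, dist_le_of_mulCayley_adj (f := ((↑) : H → G)) ?_⟩
  rintro s (hs | hs) u
  · have : (s : G) ∈ S := Or.inl (Or.inl ⟨s, hs, rfl⟩)
    have h1 := hc.edist_le_iff.1 (mulCayley_edist_mul_le_one this u)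
    rw [Subgroup.coe_mul]
    omega
  · obtain ⟨Q, hQ, hs⟩ := Set.mem_iUnion₂.1 hs
    obtain ⟨P, hP, hgP⟩ := hg Q hQ
    have hgB : (mulCayley S).dist 1 (g Q) ≤ B := hB ⟨Q, hQ, rfl⟩
    have h1 : (mulCayley S).dist (u : G) (u * (g Q)⁻¹) = (mulCayley S).dist 1 (g Q) := by
      rw [dist_comm]
      simpa using mulCayley_dist_mul_right S (u * (g Q)⁻¹) (g Q)
    have h2 : (mulCayley S).dist (u * (g Q)⁻¹ : G) (u * (g Q)⁻¹ * (g Q * s * (g Q)⁻¹)) ≤ 1 :=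
      hc.edist_le_iff.1 (mulCayley_edist_mul_le_one (S := S)
        (Or.inr (Set.mem_iUnion₂.2 ⟨P, hP, hgP s hs⟩)) _)
    have h3 := mulCayley_dist_mul_right S (u * (g Q)⁻¹ * (g Q * s * (g Q)⁻¹)) (g Q)
    rw [show u * (g Q)⁻¹ * (g Q * s * (g Q)⁻¹) * g Q = u * (s : G) by group] at h3
    have h4 := hc.dist_triangle (u := (u : G)) (v := u * (g Q)⁻¹) (w := u * s)
    have h5 := hc.dist_triangle (u := (u * (g Q)⁻¹ : G))
      (v := u * (g Q)⁻¹ * (g Q * s * (g Q)⁻¹)) (w := u * s)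
    rw [Subgroup.coe_mul]
    omega

lemma IsPeripheralExtension.exists_dist_retraction_le [H.FiniteIndex]
    (h𝒮 : IsPeripheralExtension 𝒬 𝒮)
    (hgen : Subgroup.closure (T ∪ ⋃ Q ∈ 𝒬, (Q : Set H)) = ⊤)
    (hinv : ∀ g : G, ∀ K ∈ conjugateSubgroups 𝒬,
      (MulAut.conjNormal g : MulAut H) • K ∈ conjugateSubgroups 𝒬) (hR : R.Finite)
    {N : ℕ} (hN : ∀ r ∈ R, ∀ t ∈ T, (mulCayley T).edist 1 (MulAut.conjNormal r t) ≤ N)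
    {ρ : G → H} (hρ : ∀ (h : H) (x : G), ρ (h * x) = h * ρ x)
    (hρR : ∀ x, ((ρ x : G))⁻¹ * x ∈ R) :
    ∃ A : ℕ, ∀ u v : G, (mulCayley (((↑) '' T : Set G) ∪ R ∪ ⋃ P ∈ 𝒮, (P : Set G))).Adj u v →
      (mulCayley (T ∪ ⋃ Q ∈ 𝒬, (Q : Set H))).dist (ρ u) (ρ v) ≤ A := by
  obtain ⟨F, hF, hFR, hFP⟩ := h𝒮.exists_finite_labels hinv hρ hR hρR
  have hc := mulCayley_connected hgen
  set S : Set H := T ∪ ⋃ Q ∈ 𝒬, (Q : Set H) with hS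
  obtain ⟨B, hB⟩ := (hF.image fun f => (mulCayley S).dist 1 f).bddAbove
  have hB' : ∀ f ∈ F, ∀ u, (mulCayley S).dist u (u * f) ≤ B := fun f hf u => by
    rw [mulCayley_dist_mul_right]
    exact hB ⟨f, hf, rfl⟩
  refine ⟨N + (B + 1 + B), dist_le_of_mulCayley_adj ?_⟩
  rintro s ((⟨t, ht, rfl⟩ | hs) | hs) u
  · rw [conjNormal_rho hρ, mulCayley_dist_mul_right]
    have h1 : mulCayley T ≤ mulCayley S := mulCayley_mono Set.subset_union_left
    have h2 := hc.edist_le_iff.1 ((edist_anti h1).trans (hN _ (hρR u) t ht))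
    omega
  · have := hB' _ (hFR u s hs) (ρ u)
    rw [mul_inv_cancel_left] at this
    omega
  · obtain ⟨P, hP, hs⟩ := Set.mem_iUnion₂.1 hs
    obtain ⟨k, hk, f, hf, Q, hQ, q, hq, -, h⟩ := hFP P hP u s hs
    rw [h]
    have h1 := hB' k hk (ρ u)
    have h2 := hc.edist_le_iff.1
      (mulCayley_edist_mul_le_one (Or.inr (Set.mem_iUnion₂.2 ⟨Q, hQ, hq⟩)) (ρ u * k) (S := S))
    have h3 := hB' f hf (ρ u * k * q)
    have h4 := hc.dist_triangle (u := ρ u) (v := ρ u * k) (w := ρ u * k * q)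
    have h5 := hc.dist_triangle (u := ρ u) (v := ρ u * k * q) (w := ρ u * k * q * f)
    omega

theorem IsPeripheralExtension.graphHyperbolic [H.FiniteIndex]
    (h𝒮 : IsPeripheralExtension 𝒬 𝒮) (h𝒬 : 𝒬.Finite) (hQT : HypEmbedded 𝒬 T)
    (hinv : ∀ g : G, ∀ K ∈ conjugateSubgroups 𝒬,
      (MulAut.conjNormal g : MulAut H) • K ∈ conjugateSubgroups 𝒬) (hR : R.Finite)
    {N : ℕ} (hN : ∀ r ∈ R, ∀ t ∈ T, (mulCayley T).edist 1 (MulAut.conjNormal r t) ≤ N)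
    {ρ : G → H} (hρ : ∀ (h : H) (x : G), ρ (h * x) = h * ρ x)
    (hρR : ∀ x, ((ρ x : G))⁻¹ * x ∈ R)
    (hgen : Subgroup.closure (((↑) '' T : Set G) ∪ R ∪ ⋃ P ∈ 𝒮, (P : Set G)) = ⊤) :
    GraphHyperbolic (mulCayley (((↑) '' T : Set G) ∪ R ∪ ⋃ P ∈ 𝒮, (P : Set G))) := by
  obtain ⟨A, hA⟩ := h𝒮.exists_dist_coe_le h𝒬 hgen
  obtain ⟨B, hB⟩ := h𝒮.exists_dist_retraction_le hQT.1 hinv hR hN hρ hρR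
  have hc := mulCayley_connected hgen
  refine hQT.2.1.of_coarseRetract (mulCayley_connected hQT.1) hc
    (f := ((↑) : H → G)) (g := ρ) (A := A + B + 1) (fun u v huv => (hA u v huv).trans (by omega))
    (fun u v huv => (hB u v huv).trans (by omega)) fun x => ?_
  have hx : (ρ x : G)⁻¹ * x ∈ ((↑) '' T : Set G) ∪ R ∪ ⋃ P ∈ 𝒮, (P : Set G) :=
    Or.inl (Or.inr (hρR x))
  have h1 := hc.edist_le_iff.1 (mulCayley_edist_mul_le_one hx (ρ x : G))
  rw [mul_inv_cancel_left] at h1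
  omega

/-! ### Local finiteness of the relative metrics of G -/

/-- The retraction to `H` maps edges of a relative Cayley graph of `G` to paths of bounded length
in a relative Cayley graph of `H`. -/
lemma IsPeripheralExtension.relCayleyMinus_edist_le (h𝒮 : IsPeripheralExtension 𝒬 𝒮)
    {ρ : G → H} (hρ : ∀ (h : H) (x : G), ρ (h * x) = h * ρ x)
    (hρR : ∀ x, ((ρ x : G))⁻¹ * x ∈ R) {Y : Set H}
    (hT : ∀ r ∈ R, ∀ t ∈ T, MulAut.conjNormal r t ∈ Y)
    (hFR : ∀ u, ∀ x ∈ R, (ρ u)⁻¹ * ρ (u * x) ∈ Y)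
    (hFP : ∀ P ∈ 𝒮, ∀ u, ∀ p ∈ P, ∃ k ∈ Y, ∃ f ∈ Y, ∃ Q ∈ 𝒬, ∃ q ∈ Q,
        MulAut.conj (ρ u * k) • Q = (MulAut.conjNormal u : MulAut H) • P.subgroupOf H ∧
          ρ (u * p) = ρ u * k * q * f)
    {P : Subgroup G} (hP : P ∈ 𝒮) {Q : Subgroup H} {c : H}
    (hc : P.subgroupOf H = MulAut.conj c • Q) {u v : G}
    (huv : (relCayleyMinus 𝒮 (((↑) '' T : Set G) ∪ R) P).Adj u v) :
    (relCayleyMinus 𝒬 Y Q).edist (c⁻¹ * ρ u) (c⁻¹ * ρ v) ≤ (3 : ℕ) := by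
  have hX : ∀ u, ∀ x ∈ ((↑) '' T : Set G) ∪ R,
      (relCayleyMinus 𝒬 Y Q).edist (c⁻¹ * ρ u) (c⁻¹ * ρ (u * x)) ≤ (3 : ℕ) := by
    intro u x hx
    have key : (ρ u)⁻¹ * ρ (u * x) ∈ Y := by
      rcases hx with ⟨t, ht, rfl⟩ | hx
      · rw [conjNormal_rho hρ, inv_mul_cancel_left]
        exact hT _ (hρR u) t ht
      · exact hFR u x hx
    have := relCayleyMinus_edist_mul_le_one (𝒜 := 𝒬) (P := Q) key (c⁻¹ * ρ u)
    rw [mul_assoc, mul_inv_cancel_left] at this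
    exact this.trans (by norm_num)
  obtain ⟨-, ⟨x, hx, rfl | rfl⟩ | ⟨P', hP', hp, hne⟩⟩ := huv
  · exact hX u x hx
  · rw [SimpleGraph.edist_comm]
    exact hX v x hx
  · obtain ⟨k, hk, f, hf, Q', hQ', q, hq, hconj, hv⟩ := hFP P' hP' u _ hp
    rw [mul_inv_cancel_left] at hv
    have h1 : (relCayleyMinus 𝒬 Y Q).edist (c⁻¹ * ρ u) (c⁻¹ * ρ u * k) ≤ (1 : ℕ) :=
      relCayleyMinus_edist_mul_le_one hk _
    have h2 : (relCayleyMinus 𝒬 Y Q).edist (c⁻¹ * ρ u * k) (c⁻¹ * ρ u * k * q) ≤ (1 : ℕ) := by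
      refine relCayleyMinus_edist_mul_le_one_of_mem_subgroup hQ' hq ?_
      -- If the Q-edge were removed, its coset would be that of P ∩ H = cQc⁻¹. Then u conjugates P'
      -- ∩ H to P ∩ H, so P' = P and u ∈ P: the original edge was removed as well.
      rintro ⟨rfl, hmem⟩
      refine hne (h𝒮.eq_and_mem P hP P' hP' u ?_)
      rw [← hconj, hc, show ρ u * k = c * (c⁻¹ * ρ u * k) by group, map_mul, mul_smul,
        Subgroup.conj_smul_eq_self_of_mem hmem]
    have h3 : (relCayleyMinus 𝒬 Y Q).edist (c⁻¹ * ρ u * k * q) (c⁻¹ * ρ u * k * q * f) ≤ (1 : ℕ) :=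
      relCayleyMinus_edist_mul_le_one hf _
    have := edist_le_add (edist_le_add h1 h2) h3
    rwa [show c⁻¹ * ρ u * k * q * f = c⁻¹ * ρ v by rw [hv]; group] at this

theorem IsPeripheralExtension.relLocallyFinite [H.FiniteIndex]
    (h𝒮 : IsPeripheralExtension 𝒬 𝒮) (hQT : HypEmbedded 𝒬 T)
    (hinv : ∀ g : G, ∀ K ∈ conjugateSubgroups 𝒬,
      (MulAut.conjNormal g : MulAut H) • K ∈ conjugateSubgroups 𝒬) (hR : R.Finite)
    {N : ℕ} (hN : ∀ r ∈ R, ∀ t ∈ T, (mulCayley T).edist 1 (MulAut.conjNormal r t) ≤ N)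
    {ρ : G → H} (hρ : ∀ (h : H) (x : G), ρ (h * x) = h * ρ x)
    (hρR : ∀ x, ((ρ x : G))⁻¹ * x ∈ R) :
    RelLocallyFinite 𝒮 (((↑) '' T : Set G) ∪ R) := by
  intro P hP n
  obtain ⟨Q, hQ, c, hc⟩ := h𝒮.subgroupOf_mem P hP
  obtain ⟨F, hF, hFR, hFP⟩ := h𝒮.exists_finite_labels hinv hρ hR hρR
  obtain ⟨S, hS, hSP, hrep⟩ := Subgroup.exists_finite_representatives H P
  let F' : Set H := insert (c⁻¹ * ρ 1) ((fun s => c⁻¹ * ρ s) '' S)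
  -- The ball of radius N contains the conjugates of T by R; it has bounded T-length and the rest is
  -- finite, so local finiteness survives. F' supplies the edges correcting the two endpoints.
  let Y : Set H := T ∪ {h | (mulCayley T).edist 1 h ≤ N} ∪ (F ∪ F')
  have hY : RelLocallyFinite 𝒬 Y := by
    refine ((hypEmbedded_iff.1 hQT).2.2.union_of_edist_le fun y hy => hy).union_finite
      (top_le_iff.1 ?_) (hF.union ((hS.image _).insert _))
    rw [← hQT.1]
    exact Subgroup.closure_mono (Set.union_subset_union_left _ Set.subset_union_left)
  have hFY : F ⊆ Y := fun x hx => Or.inr (Or.inl hx)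
  have hF'Y : F' ⊆ Y := fun x hx => Or.inr (Or.inr hx)
  have hlip := fun u v => h𝒮.relCayleyMinus_edist_le (u := u) (v := v) hρ hρR (Y := Y)
    (fun r hr t ht => Or.inl (Or.inr (hN r hr t ht))) (fun u x hx => hFY (hFR u x hx))
    (fun P hP u p hp => by
      obtain ⟨k, hk, f, hf, h⟩ := hFP P hP u p hp
      exact ⟨k, hFY hk, f, hFY hf, h⟩) hP hc
  -- Write p = cqc⁻¹s. Then c⁻¹ρ(p) = q · c⁻¹ρ(s) is one F'-edge from q, and c⁻¹ρ(1) is one F'-edge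
  -- from 1.
  refine (((hY Q hQ (1 + 3 * n + 1)).image fun q => ((c * q * c⁻¹ : H) : G)).mul hS).subset ?_
  rintro p ⟨hp, hpn⟩
  obtain ⟨s, hs, hps⟩ := hrep p hp
  have hq : c⁻¹ * ⟨p * s⁻¹, hps⟩ * c ∈ Q := by
    rw [← Subgroup.mem_conj_smul_iff, ← hc]
    exact Subgroup.mem_subgroupOf.2 (P.mul_mem hp (P.inv_mem (hSP hs)))
  have hp' : p = (⟨p * s⁻¹, hps⟩ : H) * s := by simp
  refine ⟨_, ⟨c⁻¹ * ⟨p * s⁻¹, hps⟩ * c, ⟨hq, ?_⟩, rfl⟩, s, hs, ?_⟩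
  · have h1 : (relCayleyMinus 𝒬 Y Q).edist 1 (c⁻¹ * ρ 1) ≤ (1 : ℕ) := by
      simpa using relCayleyMinus_edist_mul_le_one (𝒜 := 𝒬) (P := Q)
        (hF'Y (Set.mem_insert (c⁻¹ * ρ 1) _)) 1
    have h2 := edist_map_le (f := fun x => c⁻¹ * ρ x) hlip hpn
    have h3 : (relCayleyMinus 𝒬 Y Q).edist (c⁻¹ * ρ p) (c⁻¹ * ⟨p * s⁻¹, hps⟩ * c) ≤ (1 : ℕ) := by
      have := relCayleyMinus_edist_mul_le_one (𝒜 := 𝒬) (P := Q)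
        (hF'Y (Set.mem_insert_of_mem _ ⟨s, hs, rfl⟩)) (c⁻¹ * ⟨p * s⁻¹, hps⟩ * c)
      rw [SimpleGraph.edist_comm]
      convert this using 2
      conv_lhs => rw [hp', hρ]
      group
    exact edist_le_add (edist_le_add h1 h2) h3
  · change ((c * (c⁻¹ * ⟨p * s⁻¹, hps⟩ * c) * c⁻¹ : H) : G) * s = p
    rw [show c * (c⁻¹ * ⟨p * s⁻¹, hps⟩ * c) * c⁻¹ = (⟨p * s⁻¹, hps⟩ : H) by group]
    exact hp'.symm

/-! ### Assembly of the theorem -/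

theorem HypEmbedded.of_normal_finiteIndex [H.FiniteIndex] (h𝒬fin : 𝒬.Finite)
    (h𝒬inf : ∀ Q ∈ 𝒬, Infinite Q) (h𝒬 : HypEmbedded 𝒬 T)
    (hR : Subgroup.IsComplement (H : Set G) R)
    (hN : ∃ N : ℕ, ∀ r ∈ R, ∀ t ∈ T, (mulCayley T).edist 1 (MulAut.conjNormal r t) ≤ N)
    (hinv : ∀ g : G, ∀ K ∈ conjugateSubgroups 𝒬,
      (MulAut.conjNormal g : MulAut H) • K ∈ conjugateSubgroups 𝒬)
    (h𝒮 : IsRefinement ((fun Q => Q.map H.subtype) '' 𝒬) 𝒮)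
    (hgen : Subgroup.closure (((↑) '' T : Set G) ∪ R ∪ ⋃ P ∈ 𝒮, (P : Set G)) = ⊤) :
    HypEmbedded 𝒮 (((↑) '' T : Set G) ∪ R) := by
  obtain ⟨N, hN⟩ := hN
  obtain ⟨ρ, hρ, hρR⟩ := hR.exists_retraction
  have h := h𝒬.isAlmostMalnormal.isPeripheralExtension h𝒬fin h𝒬inf hinv h𝒮
  exact hypEmbedded_iff.2 ⟨hgen,
    h.graphHyperbolic h𝒬fin h𝒬 hinv hR.finite_right hN hρ hρR hgen,
    h.relLocallyFinite h𝒬 hinv hR.finite_right hN hρ hρR⟩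

lemma ConjUniformOn.exists_edist_le (h : ConjUniformOn H T R) :
    ∃ N : ℕ, ∀ r ∈ R, ∀ t ∈ T, (mulCayley T).edist 1 (MulAut.conjNormal r t) ≤ N := by
  obtain ⟨L, C, -, h⟩ := h
  obtain ⟨N, hN⟩ := exists_nat_ge (L + C)
  refine ⟨N, fun r hr t ht => ?_⟩
  have h1 := (h r hr).1 1 t
  have h2 : (mulCayley T).edist 1 t ≤ 1 := by simpa using mulCayley_edist_mul_le_one ht 1
  have h3 : (((mulCayley T).edist 1 t : ℕ∞) : ℝ≥0∞) ≤ 1 := by exact_mod_cast h2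
  simp only [map_one] at h1
  have h4 : (((mulCayley T).edist 1 (MulAut.conjNormal r t) : ℕ∞) : ℝ≥0∞) ≤ (N : ℝ≥0∞) := by
    refine h1.trans ((add_le_add_left (mul_le_mul_right h3 _) _).trans ?_)
    rw [mul_one]
    exact_mod_cast hN
  exact_mod_cast h4

end Normal

theorem theoremE {G : Type*} [Group G] [Group.FG G] (H : Subgroup G) [H.Normal] [H.FiniteIndex]
    (𝒬 : Set (Subgroup H)) (h𝒬fin : 𝒬.Finite) (h𝒬inf : ∀ Q ∈ 𝒬, Infinite Q)
    (T : Set H) (h𝒬 : HypEmbedded 𝒬 T)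
    (R : Set G) (hR : Subgroup.IsComplement (H : Set G) R)
    (hconj : ConjUniformOn H T R)
    (hinv : ∀ g : G, ∀ K ∈ conjugateSubgroups 𝒬,
      (MulAut.conjNormal g : MulAut H) • K ∈ conjugateSubgroups 𝒬)
    (𝒬' : Set (Subgroup G)) (h𝒬' : IsRefinement ((fun Q => Q.map H.subtype) '' 𝒬) 𝒬') :
    (Subgroup.closure (((↑) '' T : Set G) ∪ R ∪ ⋃ P ∈ 𝒬', (P : Set G)) = ⊤ →
      HypEmbedded 𝒬' (((↑) '' T : Set G) ∪ R)) ∧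
    ∃ F : Set H, F.Finite ∧ HypEmbedded 𝒬' (((↑) '' (T ∪ F) : Set G) ∪ R) := by
  have hN := hconj.exists_edist_le
  refine ⟨h𝒬.of_normal_finiteIndex h𝒬fin h𝒬inf hR hN hinv h𝒬', ?_⟩
  -- A finite-index subgroup of a finitely generated group is finitely generated; F is a finite
  -- generating set of H. The conjugates of F by the finite set R have bounded length M.
  obtain ⟨F, hF⟩ := Group.FG.out (G := H)
  refine ⟨F, F.finite_toSet, (h𝒬.union_finite F.finite_toSet).of_normal_finiteIndex h𝒬fin h𝒬inf hR
    ?_ hinv h𝒬' ?_⟩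
  · obtain ⟨N, hN⟩ := hN
    have hTF : Subgroup.closure (T ∪ F) = ⊤ :=
      top_le_iff.1 (hF ▸ Subgroup.closure_mono Set.subset_union_right)
    have hc := mulCayley_connected hTF
    obtain ⟨M, hM⟩ := ((hR.finite_right.prod F.finite_toSet).image fun x =>
      (mulCayley (T ∪ F)).dist 1 (MulAut.conjNormal x.1 x.2)).bddAbove
    refine ⟨N + M, fun r hr t ht => ?_⟩
    rcases ht with ht | ht
    · refine (edist_anti (mulCayley_mono Set.subset_union_left)).trans ((hN r hr t ht).trans ?_)
      exact_mod_cast Nat.le_add_right N M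
    · have h1 : (mulCayley (T ∪ F)).dist 1 (MulAut.conjNormal r t) ≤ M := hM ⟨(r, t), ⟨hr, ht⟩, rfl⟩
      exact hc.edist_le_iff.2 (by omega)
  · obtain ⟨ρ, -, hρR⟩ := hR.exists_retraction
    refine top_le_iff.1 fun x _ => ?_
    have hH : ∀ h : H, (h : G) ∈ Subgroup.closure (((↑) '' (T ∪ F) : Set G) ∪ R ∪
        ⋃ P ∈ 𝒬', (P : Set G)) := by
      intro h
      have : h ∈ Subgroup.closure (F : Set H) := by rw [hF]; trivial
      have h2 := Subgroup.mem_map_of_mem H.subtype this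
      rw [MonoidHom.map_closure] at h2
      refine Subgroup.closure_mono ?_ h2
      rintro _ ⟨y, hy, rfl⟩
      exact Or.inl (Or.inl ⟨y, Or.inr hy, rfl⟩)
    rw [← mul_inv_cancel_left (ρ x : G) x]
    exact Subgroup.mul_mem _ (hH _) (Subgroup.subset_closure (Or.inl (Or.inr (hρR x))))
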